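/- Let $(M,d)$, $(N,\partial)$ be pseudometric spaces. For a map $f\colon M\to N$ and $t\ge 0$ put $$\omega_f(t)=\sup\{\partial(f(x),f(y)) : d(x,y)\le t\},\qquad \rho_f(t)=\inf\{\partial(f(x),f(y)) : d(x,y)\ge t\}$$ (with values in $[0,\infty]$, $\inf\emptyset=\infty$). The map $f$ is \emph{coarse} if $\omega_f(t)<\infty$ for all $t\ge 0$; a \emph{coarse embedding} if it is coarse and $\lim_{t\to\infty}\rho_f(t)=\infty$; and a \emph{coarse equivalence} if it is a coarse embedding and $\sup_{y\in N}\inf_{x\in M}\partial(y,f(x))<\infty$. The space $(M,d)$ (or $d$ itself) is \emph{stable} if $$\lim_{i,\mathcal U}\lim_{j,\mathcal V}d(x_i,y_j)=\lim_{j,\mathcal V}\lim_{i,\mathcal U}d(x_i,y_j)$$ for all $d$-bounded sequences $(x_i)$, $(y_j)$ in $M$ and all nonprincipal ultrafilters $\mathcal U,\mathcal V$ on $\mathbb N$. A (real) Banach space is \emph{stable} if its norm metric is, and a Banach space $Y$ is \emph{superstable} if every Banach space that is finitely representable in $Y$ is stable; here $Z$ is \emph{finitely representable} in $Y$ if for every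 finite-dimensional subspace $E\subseteq Z$ and every $\varepsilon>0$ there is a linear map $T\colon E\to Y$ with $\|e\|\le\|Te\|\le(1+\varepsilon)\|e\|$ for all $e\in E$. A pseudometric $d$ on a Banach space $X$ is \emph{translation-invariant} if $d(x,y)=d(x-y,0)$ for all $x,y\in X$. Let $(X,\|\cdot\|)$ be a Banach space, let $Y$ be a superstable Banach space, and let $f\colon X\to Y$ be a coarse map. Then there exists a translation-invariant stable pseudometric $d$ on $X$ such that $$\rho_f(\|x-y\|)\le d(x,y)\le \omega_f(\|x-y\|)\qquad\text{for all } x,y\in X.$$ In particular, if $X$ coarsely embeds into a superstable Banach space, then there exists a translation-invariant stable pseudometric $d$ on $X$ such that the identity map $\mathrm{Id}\colon (X,\|\cdot\|)\to(X,d)$ is a coarse equivalence. -/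

import Mathlib

open scoped ENNReal Topology

/-- The metric `(x, y) ↦ ‖x - y‖` of a normed space, as a bundled pseudometric. -/
def normMetric (X : Type*) [NormedAddCommGroup X] : PseudoMetric X ℝ where
  toFun x y := ‖x - y‖
  refl' x := by simp
  symm' x y := norm_sub_rev x y
  triangle' x y z := norm_sub_le_norm_sub_add_norm_sub x y z

section Moduli

variable {M N : Type*}

/-- `ω_f(t) = sup {d'(f x, f y) | d(x, y) ≤ t}`, with values in `[0, ∞]`. -/
noncomputable def expansionModulus (d : PseudoMetric M ℝ) (d' : PseudoMetric N ℝ) (f : M → N)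
    (t : ℝ) : ℝ≥0∞ :=
  ⨆ (x : M) (y : M) (_ : d x y ≤ t), ENNReal.ofReal (d' (f x) (f y))

/-- `ρ_f(t) = inf {d'(f x, f y) | d(x, y) ≥ t}`, with values in `[0, ∞]` (and `inf ∅ = ∞`). -/
noncomputable def compressionModulus (d : PseudoMetric M ℝ) (d' : PseudoMetric N ℝ) (f : M → N)
    (t : ℝ) : ℝ≥0∞ :=
  ⨅ (x : M) (y : M) (_ : t ≤ d x y), ENNReal.ofReal (d' (f x) (f y))

/-- `f` is coarse: `ω_f(t) < ∞` for all `t ≥ 0`. -/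
def IsCoarse (d : PseudoMetric M ℝ) (d' : PseudoMetric N ℝ) (f : M → N) : Prop :=
  ∀ t : ℝ, 0 ≤ t → expansionModulus d d' f t < ∞

/-- `f` is expanding: `ρ_f(t) → ∞` as `t → ∞`. -/
def IsExpanding (d : PseudoMetric M ℝ) (d' : PseudoMetric N ℝ) (f : M → N) : Prop :=
  Filter.Tendsto (compressionModulus d d' f) Filter.atTop (𝓝 ∞)

/-- A coarse embedding is a map that is both coarse and expanding. -/
def IsCoarseEmbedding (d : PseudoMetric M ℝ) (d' : PseudoMetric N ℝ) (f : M → N) : Prop :=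
  IsCoarse d d' f ∧ IsExpanding d d' f

/-- `f` is cobounded: the distances of the points of the codomain to the range of `f` are
bounded. -/
def IsCobounded (d' : PseudoMetric N ℝ) (f : M → N) : Prop :=
  (⨆ y : N, ⨅ x : M, ENNReal.ofReal (d' y (f x))) < ∞

/-- A coarse equivalence is a cobounded coarse embedding. -/
def IsCoarseEquivalence (d : PseudoMetric M ℝ) (d' : PseudoMetric N ℝ) (f : M → N) : Prop :=
  IsCoarseEmbedding d d' f ∧ IsCobounded d' f

/-- A sequence that is bounded for the pseudometric `d`. -/
def IsBoundedSeq (d : PseudoMetric M ℝ) (x : ℕ → M) : Prop :=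
  ∃ C : ℝ, ∀ i j, d (x i) (x j) ≤ C

/-- Stability of `(M, d)`: for all bounded sequences `x`, `y` and all nonprincipal ultrafilters
`U`, `V` on `ℕ`, the iterated limits `lim_{i,U} lim_{j,V} d(x_i, y_j)` and
`lim_{j,V} lim_{i,U} d(x_i, y_j)` agree. (All these limits exist, by boundedness; `g`, `h` are the
inner limits and `L` is the common value.) -/
def PseudoMetric.IsStable (d : PseudoMetric M ℝ) : Prop :=
  ∀ x y : ℕ → M, IsBoundedSeq d x → IsBoundedSeq d y →
    ∀ U V : Ultrafilter ℕ, (∀ n, U ≠ pure n) → (∀ n, V ≠ pure n) →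
      ∃ (g h : ℕ → ℝ) (L : ℝ),
        (∀ i, Filter.Tendsto (fun j => d (x i) (y j)) V (𝓝 (g i))) ∧
        (∀ j, Filter.Tendsto (fun i => d (x i) (y j)) U (𝓝 (h j))) ∧
        Filter.Tendsto g U (𝓝 L) ∧ Filter.Tendsto h V (𝓝 L)

end Moduli

/-- `d(x, y) = d(x - y, 0)` for all `x`, `y`. -/
def PseudoMetric.IsTranslationInvariant {X : Type*} [AddGroup X] (d : PseudoMetric X ℝ) : Prop :=
  ∀ x y : X, d x y = d (x - y) 0

/-- `Z` is finitely representable in `Y`: for every `ε > 0`, every finite-dimensional subspace of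
`Z` is `(1 + ε)`-isomorphic to a subspace of `Y`. -/
def FinitelyRepresentable (Z Y : Type*) [NormedAddCommGroup Z] [NormedSpace ℝ Z]
    [NormedAddCommGroup Y] [NormedSpace ℝ Y] : Prop :=
  ∀ E : Submodule ℝ Z, FiniteDimensional ℝ E → ∀ ε : ℝ, 0 < ε →
    ∃ T : E →ₗ[ℝ] Y, ∀ e : E, ‖e‖ ≤ ‖T e‖ ∧ ‖T e‖ ≤ (1 + ε) * ‖e‖

/-- `Y` is superstable: every Banach space that is finitely representable in `Y` is stable.
(Stability concerns countably many points and finite representability passes to subspaces, so only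
separable spaces matter; these have copies in every universe.) -/
def IsSuperstable.{u} (Y : Type u) [NormedAddCommGroup Y] [NormedSpace ℝ Y] : Prop :=
  ∀ (Z : Type u) [NormedAddCommGroup Z] [NormedSpace ℝ Z] [CompleteSpace Z],
    FinitelyRepresentable Z Y → (normMetric Z).IsStable

/-!
Averaging the pseudometrics `(x, y) ↦ ‖f (x + z) - f (y + z)‖` over `z` with an invariant mean gives
a translation-invariant pseudometric that lies between the moduli of `f`; the point is its
stability. A mean is the integral against a probability measure on the space of ultrafilters, and
along a single ultrafilter the distances `‖x i z - y j z‖` become distances in an ultrapower of `Y`,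
which is stable. Once truncated at a level `C`, they keep their double limits under the integral:
convex combinations preserve double limits (Grothendieck), and by Mazur's lemma suitable ones
converge almost everywhere. As `C` grows, the mean of the part cut off tends to the sum of the
masses of `x i` and of `y j` that escape to infinity, whatever the order of the two limits.
-/

open Filter MeasureTheory Set

section Ultralimits

variable {ι κ : Type*} {U : Ultrafilter ι} {f g : ι → ℝ} {C : ℝ}

/-- The space of bounded real functions on `ι`. -/
def boundedFunctions (ι : Type*) : Submodule ℝ (ι → ℝ) where
  carrier := {f | ∃ C, ∀ i, |f i| ≤ C}
  zero_mem' := ⟨0, fun _ => by simp⟩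
  add_mem' := fun ⟨C, hC⟩ ⟨D, hD⟩ =>
    ⟨C + D, fun i => (abs_add_le _ _).trans (add_le_add (hC i) (hD i))⟩
  smul_mem' c _ := fun ⟨C, hC⟩ => ⟨|c| * C, fun i => by
    simpa only [Pi.smul_apply, smul_eq_mul, abs_mul] using
      mul_le_mul_of_nonneg_left (hC i) (abs_nonneg c)⟩

theorem const_mem_boundedFunctions (c : ℝ) : (fun _ => c) ∈ boundedFunctions ι :=
  ⟨|c|, fun _ => le_rfl⟩

/-- The limit of a real function along an ultrafilter; it exists when the function is bounded. -/
noncomputable def ulim (U : Ultrafilter ι) (f : ι → ℝ) : ℝ := limUnder (U : Filter ι) f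

theorem ulim_eq {l : ℝ} (h : Tendsto f U (𝓝 l)) : ulim U f = l := h.limUnder_eq

theorem tendsto_ulim (hf : f ∈ boundedFunctions ι) : Tendsto f U (𝓝 (ulim U f)) := by
  obtain ⟨C, hC⟩ := hf
  obtain ⟨l, -, hl⟩ := isCompact_Icc.ultrafilter_le_nhds (U.map f)
    (le_principal_iff.2 (mem_map.2 (univ_mem' fun i => abs_le.1 (hC i))))
  exact tendsto_nhds_limUnder ⟨l, hl⟩

theorem abs_ulim_le (hC : ∀ i, |f i| ≤ C) : |ulim U f| ≤ C :=
  le_of_tendsto (tendsto_ulim ⟨C, hC⟩).abs (Eventually.of_forall hC)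

theorem ulim_congr (h : f =ᶠ[U] g) : ulim U f = ulim U g := by
  simp only [ulim, limUnder, map_congr h]

theorem ulim_map (U : Ultrafilter κ) (s : κ → ι) (f : ι → ℝ) :
    ulim (U.map s) f = ulim U (f ∘ s) := by
  simp only [ulim, limUnder, Ultrafilter.coe_map, Filter.map_map]

theorem ulim_pure (i : ι) (f : ι → ℝ) : ulim (pure i) f = f i :=
  ulim_eq (tendsto_pure_nhds f i)

theorem ulim_const (c : ℝ) : (ulim U fun _ => c) = c := ulim_eq tendsto_const_nhds

theorem ulim_add (hf : f ∈ boundedFunctions ι) (hg : g ∈ boundedFunctions ι) :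
    (ulim U fun i => f i + g i) = ulim U f + ulim U g :=
  ulim_eq ((tendsto_ulim hf).add (tendsto_ulim hg))

theorem ulim_smul (c : ℝ) (hf : f ∈ boundedFunctions ι) :
    (ulim U fun i => c * f i) = c * ulim U f :=
  ulim_eq ((tendsto_ulim hf).const_mul c)

theorem ulim_nonneg (hf : f ∈ boundedFunctions ι) (h : ∀ i, 0 ≤ f i) : 0 ≤ ulim U f :=
  ge_of_tendsto (tendsto_ulim hf) (Eventually.of_forall h)

theorem ulim_mem_boundedFunctions (U : Ultrafilter κ) {a : ι → κ → ℝ} (h : ∀ i k, |a i k| ≤ C) :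
    (fun i => ulim U (a i)) ∈ boundedFunctions ι :=
  ⟨C, fun i => abs_ulim_le (h i)⟩

theorem continuous_ulim (hf : f ∈ boundedFunctions ι) :
    Continuous fun U : Ultrafilter ι => ulim U f := by
  obtain ⟨C, hC⟩ := hf
  let F : ι → Icc (-C) C := fun i => ⟨f i, abs_le.1 (hC i)⟩
  have hF : (fun U : Ultrafilter ι => ulim U f) = fun U => (Ultrafilter.extend F U).1 := by
    funext U
    have hU : Tendsto F U (𝓝 (Ultrafilter.extend F U)) := ultrafilter_extend_eq_iff.1 rfl
    exact ulim_eq (((continuous_subtype_val.tendsto _).comp hU))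
  rw [hF]
  exact continuous_subtype_val.comp (continuous_ultrafilter_extend F)

theorem exists_seq_tendsto_of_tendsto_ultrafilter {β : Type*} [Countable κ] (V : Ultrafilter β)
    {a : κ → β → ℝ} {l : κ → ℝ} (h : ∀ k, Tendsto (a k) V (𝓝 (l k))) :
    ∃ s : ℕ → β, ∀ k, Tendsto (fun n => a k (s n)) atTop (𝓝 (l k)) := by
  have hl : l ∈ closure (range fun j k => a k j) :=
    mem_closure_of_tendsto (tendsto_pi_nhds.2 h) (Eventually.of_forall mem_range_self)
  obtain ⟨v, hv, hvl⟩ := mem_closure_iff_seq_limit.1 hl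
  choose s hs using hv
  refine ⟨s, fun k => ?_⟩
  simpa only [← hs] using tendsto_pi_nhds.1 hvl k

end Ultralimits

section DoubleLimits

variable {α β : Type*} {a : α → β → ℝ}

/-- Grothendieck's double limit property: the iterated limits of the array `a` along any two
ultrafilters agree. It is meant for bounded arrays, for which all these limits exist. -/
def HasDoubleLimits (a : α → β → ℝ) : Prop :=
  ∀ (U : Ultrafilter α) (V : Ultrafilter β),
    (ulim U fun i => ulim V (a i)) = ulim V fun j => ulim U fun i => a i j

theorem HasDoubleLimits.swap (ha : HasDoubleLimits a) : HasDoubleLimits fun j i => a i j :=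
  fun V U => (ha U V).symm

theorem HasDoubleLimits.tendsto_of_tendsto {a : ℕ → ℕ → ℝ} (ha : HasDoubleLimits a)
    {p q : ℕ → ℝ} {l : ℝ} (hp : ∀ m, Tendsto (a m) atTop (𝓝 (p m))) (hpl : Tendsto p atTop (𝓝 l))
    (hq : ∀ n, Tendsto (fun m => a m n) atTop (𝓝 (q n))) (hqC : q ∈ boundedFunctions ℕ) :
    Tendsto q atTop (𝓝 l) := by
  refine tendsto_iff_ultrafilter _ _ _ |>.2 fun V hV => ?_
  have := ha (hyperfilter ℕ) V
  simp only [ulim_eq ((hp _).mono_left hV), ulim_eq ((hq _).mono_left Nat.hyperfilter_le_atTop),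
    ulim_eq (hpl.mono_left Nat.hyperfilter_le_atTop)] at this
  exact this ▸ tendsto_ulim hqC

end DoubleLimits

/-- A mean on `ι`: a positive linear functional of total mass one on the bounded functions on `ι`.
For convenience it is linear on all functions; its values at unbounded functions are irrelevant. -/
structure IsMean {ι : Type*} (M : (ι → ℝ) →ₗ[ℝ] ℝ) : Prop where
  nonneg : ∀ f ∈ boundedFunctions ι, (∀ i, 0 ≤ f i) → 0 ≤ M f
  map_one : M 1 = 1

section Means

variable {ι κ : Type*} {M : (ι → ℝ) →ₗ[ℝ] ℝ} {f g : ι → ℝ} {C : ℝ}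

namespace IsMean

theorem mono (hM : IsMean M) (hf : f ∈ boundedFunctions ι) (hg : g ∈ boundedFunctions ι)
    (h : ∀ i, f i ≤ g i) : M f ≤ M g := by
  rw [← sub_nonneg, ← map_sub]
  exact hM.nonneg _ (sub_mem hg hf) fun i => sub_nonneg.2 (h i)

theorem map_const (hM : IsMean M) (c : ℝ) : (M fun _ => c) = c := by
  have h : (fun _ : ι => c) = c • (1 : ι → ℝ) := by
    funext i
    simp only [Pi.smul_apply, Pi.one_apply, smul_eq_mul, mul_one]
  rw [h, map_smul, hM.map_one, smul_eq_mul, mul_one]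

theorem le_const (hM : IsMean M) (hf : f ∈ boundedFunctions ι) (h : ∀ i, f i ≤ C) : M f ≤ C :=
  (hM.mono hf (const_mem_boundedFunctions C) h).trans_eq (hM.map_const C)

theorem const_le (hM : IsMean M) (hf : f ∈ boundedFunctions ι) (h : ∀ i, C ≤ f i) : C ≤ M f :=
  (hM.map_const C).symm.trans_le (hM.mono (const_mem_boundedFunctions C) hf h)

theorem abs_map_le (hM : IsMean M) (h : ∀ i, |f i| ≤ C) : |M f| ≤ C :=
  abs_le.2 ⟨hM.const_le ⟨C, h⟩ fun i => (abs_le.1 (h i)).1,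
    hM.le_const ⟨C, h⟩ fun i => (abs_le.1 (h i)).2⟩

end IsMean

theorem isMean_proj (i : ι) : IsMean (LinearMap.proj i : (ι → ℝ) →ₗ[ℝ] ℝ) :=
  ⟨fun _ _ h => h i, rfl⟩

theorem convex_setOf_isMean : Convex ℝ {M : (ι → ℝ) →ₗ[ℝ] ℝ | IsMean M} := by
  intro M hM N hN s t hs ht hst
  refine ⟨fun f hf h => ?_, ?_⟩
  · exact add_nonneg (mul_nonneg hs (hM.nonneg f hf h)) (mul_nonneg ht (hN.nonneg f hf h))
  · simpa only [LinearMap.add_apply, LinearMap.smul_apply, hM.map_one, hN.map_one, smul_eq_mul,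
      mul_one] using hst

theorem exists_isMean_eq_ulim {M : κ → (ι → ℝ) →ₗ[ℝ] ℝ} (hM : ∀ k, IsMean (M k))
    (U : Ultrafilter κ) :
    ∃ L : (ι → ℝ) →ₗ[ℝ] ℝ, IsMean L ∧ ∀ f ∈ boundedFunctions ι, L f = ulim U fun k => M k f := by
  have hbdd : ∀ f ∈ boundedFunctions ι, (fun k => M k f) ∈ boundedFunctions κ :=
    fun f ⟨C, hC⟩ => ⟨C, fun k => (hM k).abs_map_le hC⟩
  let L₀ : boundedFunctions ι →ₗ[ℝ] ℝ :=
    { toFun f := ulim U fun k => M k f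
      map_add' f g := by
        simpa only [Submodule.coe_add, map_add] using ulim_add (hbdd f f.2) (hbdd g g.2)
      map_smul' c f := by
        simpa only [Submodule.coe_smul, map_smul, smul_eq_mul, RingHom.id_apply] using
          ulim_smul c (hbdd f f.2) }
  obtain ⟨L, hL⟩ := L₀.exists_extend
  have hL' : ∀ f ∈ boundedFunctions ι, L f = ulim U fun k => M k f := fun f hf =>
    LinearMap.congr_fun hL ⟨f, hf⟩
  refine ⟨L, ⟨fun f hf h => ?_, ?_⟩, hL'⟩
  · exact hL' f hf ▸ ulim_nonneg (hbdd f hf) fun k => (hM k).nonneg f hf h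
  · rw [hL' 1 (const_mem_boundedFunctions 1)]
    simp only [(hM _).map_one, ulim_const]

end Means

section InvariantMeans

variable {G : Type*} [AddCommGroup G]

/-- Invariance of `M` under the translation by `g`, required on bounded functions only. -/
def IsInvariantUnder (M : (G → ℝ) →ₗ[ℝ] ℝ) (g : G) : Prop :=
  ∀ f ∈ boundedFunctions G, (M fun x => f (x + g)) = M f

theorem comp_mem_boundedFunctions {ι κ : Type*} {f : ι → ℝ} (hf : f ∈ boundedFunctions ι)
    (s : κ → ι) : (fun k => f (s k)) ∈ boundedFunctions κ := by
  obtain ⟨C, hC⟩ := hf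
  exact ⟨C, fun k => hC (s k)⟩

/-- The average of the values of a function at `0, g, …, n • g`. -/
noncomputable def cesaroMean (g : G) (n : ℕ) : (G → ℝ) →ₗ[ℝ] ℝ :=
  ∑ k ∈ Finset.range (n + 1), (n + 1 : ℝ)⁻¹ • LinearMap.proj (k • g)

theorem isMean_cesaroMean (g : G) (n : ℕ) : IsMean (cesaroMean g n) := by
  refine convex_setOf_isMean.sum_mem (fun _ _ => by positivity) ?_ fun k _ => isMean_proj (k • g)
  rw [Finset.sum_const, Finset.card_range, nsmul_eq_mul, Nat.cast_add_one]
  exact mul_inv_cancel₀ (by positivity)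

theorem cesaroMean_translate_sub (g : G) (n : ℕ) (f : G → ℝ) :
    cesaroMean g n (fun x => f (x + g)) - cesaroMean g n f =
      (n + 1 : ℝ)⁻¹ * (f ((n + 1) • g) - f 0) := by
  simp only [cesaroMean, LinearMap.sum_apply, LinearMap.smul_apply, LinearMap.proj_apply,
    smul_eq_mul, ← Finset.mul_sum, ← mul_sub, ← succ_nsmul, ← Finset.sum_sub_distrib]
  rw [Finset.sum_range_sub fun k => f (k • g), zero_nsmul]

theorem exists_isMean_isInvariantUnder (g : G) :
    ∃ M : (G → ℝ) →ₗ[ℝ] ℝ, IsMean M ∧ IsInvariantUnder M g := by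
  obtain ⟨M, hM, hlim⟩ := exists_isMean_eq_ulim (isMean_cesaroMean g) (hyperfilter ℕ)
  refine ⟨M, hM, fun f hf => ?_⟩
  have hf' : (fun x => f (x + g)) ∈ boundedFunctions G := comp_mem_boundedFunctions hf (· + g)
  rw [← sub_eq_zero, ← map_sub, hlim _ (sub_mem hf' hf)]
  refine ulim_eq (Tendsto.mono_left ?_ Nat.hyperfilter_le_atTop)
  simp only [map_sub, cesaroMean_translate_sub]
  obtain ⟨C, hC⟩ := hf
  refine squeeze_zero_norm (a := fun n : ℕ => (1 / ((n : ℝ) + 1)) * (C + C)) (fun n => ?_) ?_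
  · rw [norm_mul, one_div, Real.norm_of_nonneg (by positivity), Real.norm_eq_abs]
    exact mul_le_mul_of_nonneg_left ((abs_sub _ _).trans (add_le_add (hC _) (hC _))) (by positivity)
  · simpa only [zero_mul] using tendsto_one_div_add_atTop_nhds_zero_nat.mul_const (C + C)

/-- The convolution of two functionals. -/
def meanConvolution (M N : (G → ℝ) →ₗ[ℝ] ℝ) : (G → ℝ) →ₗ[ℝ] ℝ :=
  M ∘ₗ LinearMap.pi fun x => N ∘ₗ LinearMap.funLeft ℝ ℝ fun y => x + y

variable {M N : (G → ℝ) →ₗ[ℝ] ℝ}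

theorem meanConvolution_apply (f : G → ℝ) :
    meanConvolution M N f = M fun x => N fun y => f (x + y) := rfl

theorem IsMean.convolution_mem_boundedFunctions (hN : IsMean N) {f : G → ℝ}
    (hf : f ∈ boundedFunctions G) : (fun x => N fun y => f (x + y)) ∈ boundedFunctions G := by
  obtain ⟨C, hC⟩ := hf
  exact ⟨C, fun x => hN.abs_map_le fun y => hC (x + y)⟩

theorem IsMean.meanConvolution (hM : IsMean M) (hN : IsMean N) : IsMean (meanConvolution M N) where
  nonneg f hf h := hM.nonneg _ (hN.convolution_mem_boundedFunctions hf) fun x =>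
    hN.nonneg _ (comp_mem_boundedFunctions hf (x + ·)) fun y => h (x + y)
  map_one := by
    rw [meanConvolution_apply]
    exact (congrArg M (funext fun _ => hN.map_one)).trans hM.map_one

theorem IsInvariantUnder.meanConvolution_right {g : G} (hN : IsInvariantUnder N g) :
    IsInvariantUnder (meanConvolution M N) g := fun f hf => by
  simp only [meanConvolution_apply, add_assoc]
  exact congrArg M (funext fun x => hN _ (comp_mem_boundedFunctions hf (x + ·)))

theorem IsInvariantUnder.meanConvolution_left {g : G} (hM : IsInvariantUnder M g) (hN : IsMean N) :
    IsInvariantUnder (meanConvolution M N) g := fun f hf => by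
  simp only [meanConvolution_apply, add_right_comm _ _ g]
  exact hM _ (hN.convolution_mem_boundedFunctions hf)

theorem exists_isMean_forall_mem_isInvariantUnder (s : Finset G) :
    ∃ M : (G → ℝ) →ₗ[ℝ] ℝ, IsMean M ∧ ∀ g ∈ s, IsInvariantUnder M g := by
  classical
  induction s using Finset.induction_on with
  | empty => exact ⟨_, isMean_proj 0, fun g hg => absurd hg (Finset.notMem_empty g)⟩
  | insert g s _ ih =>
    obtain ⟨M, hM, hMs⟩ := ih
    obtain ⟨N, hN, hNg⟩ := exists_isMean_isInvariantUnder g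
    exact ⟨meanConvolution M N, hM.meanConvolution hN, (Finset.forall_mem_insert ..).2
      ⟨hNg.meanConvolution_right, fun h hh => (hMs h hh).meanConvolution_left hN⟩⟩

variable (G) in
theorem exists_isMean_forall_isInvariantUnder :
    ∃ M : (G → ℝ) →ₗ[ℝ] ℝ, IsMean M ∧ ∀ g, IsInvariantUnder M g := by
  choose N hN hNs using exists_isMean_forall_mem_isInvariantUnder (G := G)
  obtain ⟨M, hM, hlim⟩ := exists_isMean_eq_ulim hN (Ultrafilter.of atTop)
  refine ⟨M, hM, fun g f hf => ?_⟩
  rw [hlim _ (comp_mem_boundedFunctions hf (· + g)), hlim f hf]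
  refine ulim_congr (Ultrafilter.of_le _ ?_)
  filter_upwards [eventually_ge_atTop {g}] with s hs
  exact hNs s g (Finset.singleton_subset_iff.1 hs) f hf

end InvariantMeans

section Representation

theorem exists_isProbabilityMeasure_integral_eq {A : Type*} [TopologicalSpace A] [CompactSpace A]
    [T2Space A] [MeasurableSpace A] [BorelSpace A] (Λ : C(A, ℝ) →ₗ[ℝ] ℝ)
    (hpos : ∀ f : C(A, ℝ), (∀ x, 0 ≤ f x) → 0 ≤ Λ f) (h1 : Λ 1 = 1) :
    ∃ μ : Measure A, IsProbabilityMeasure μ ∧ ∀ f : C(A, ℝ), ∫ x, f x ∂μ = Λ f := by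
  let toC : CompactlySupportedContinuousMap A ℝ →ₗ[ℝ] C(A, ℝ) :=
    { toFun := fun f => f.toContinuousMap
      map_add' := fun _ _ => rfl
      map_smul' := fun _ _ => rfl }
  let Λ' : CompactlySupportedContinuousMap A ℝ →ₚ[ℝ] ℝ :=
    PositiveLinearMap.mk₀ (Λ.comp toC) fun f hf => hpos _ fun x => hf x
  have key : ∀ f : C(A, ℝ), ∫ x, f x ∂(RealRMK.rieszMeasure Λ') = Λ f := fun f =>
    RealRMK.integral_rieszMeasure Λ' (CompactlySupportedContinuousMap.continuousMapEquiv f)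
  refine ⟨RealRMK.rieszMeasure Λ', ⟨?_⟩, key⟩
  have := key 1
  simp only [ContinuousMap.one_apply, integral_const, smul_eq_mul, mul_one, h1] at this
  rw [Measure.real, ENNReal.toReal_eq_one_iff] at this
  exact this

variable {ι κ β : Type*} {M : (ι → ℝ) →ₗ[ℝ] ℝ} {a : ι → β → ℝ} {C : ℝ}

theorem IsMean.exists_measure [MeasurableSpace (Ultrafilter ι)] [BorelSpace (Ultrafilter ι)]
    (hM : IsMean M) :
    ∃ μ : Measure (Ultrafilter ι), IsProbabilityMeasure μ ∧
      ∀ f ∈ boundedFunctions ι, M f = ∫ W, ulim W f ∂μ := by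
  have hbdd : ∀ φ : C(Ultrafilter ι, ℝ), (fun i => φ (pure i)) ∈ boundedFunctions ι := fun φ =>
    ⟨‖φ‖, fun i => φ.norm_coe_le_norm (pure i)⟩
  let Λ : C(Ultrafilter ι, ℝ) →ₗ[ℝ] ℝ :=
    { toFun φ := M fun i => φ (pure i)
      map_add' _ _ := map_add M _ _
      map_smul' c _ := map_smul M c _ }
  obtain ⟨μ, hμ, hint⟩ := exists_isProbabilityMeasure_integral_eq Λ
    (fun φ h => hM.nonneg _ (hbdd φ) fun i => h (pure i)) hM.map_one
  refine ⟨μ, hμ, fun f hf => .trans ?_ (hint ⟨fun W => ulim W f, continuous_ulim hf⟩).symm⟩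
  exact congrArg M (funext fun i => (ulim_pure i f).symm)

theorem HasDoubleLimits.isMean_map_ulim [Countable ι] (ha : HasDoubleLimits a)
    (hC : ∀ i j, |a i j| ≤ C) (hM : IsMean M) (V : Ultrafilter β) :
    (M fun i => ulim V (a i)) = ulim V fun j => M fun i => a i j := by
  borelize (Ultrafilter ι)
  obtain ⟨μ, hμ, hint⟩ := hM.exists_measure
  have hcol : ∀ j, (fun i => a i j) ∈ boundedFunctions ι := fun j => ⟨C, fun i => hC i j⟩
  have hlim : (fun i => ulim V (a i)) ∈ boundedFunctions ι := ulim_mem_boundedFunctions V hC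
  obtain ⟨s, hs⟩ := exists_seq_tendsto_of_tendsto_ultrafilter V
    (a := fun k : Option ι => k.elim (fun j => M fun i => a i j) a)
    (l := fun k => k.elim (ulim V fun j => M fun i => a i j) fun i => ulim V (a i)) (by
      rintro (_ | i)
      · exact tendsto_ulim ⟨C, fun j => hM.abs_map_le fun i => hC i j⟩
      · exact tendsto_ulim ⟨C, hC i⟩)
  have hpoint : ∀ W : Ultrafilter ι, Tendsto (fun n => ulim W fun i => a i (s n)) atTop
      (𝓝 (ulim W fun i => ulim V (a i))) := fun W => by
    refine (tendsto_iff_ultrafilter _ _ _).2 fun T hT => ?_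
    have hrow : ∀ i, (ulim T fun n => a i (s n)) = ulim V (a i) := fun i =>
      ulim_eq ((hs (some i)).mono_left hT)
    have hW := ha W (T.map s)
    simp only [ulim_map, Function.comp_def, hrow] at hW
    exact hW ▸ tendsto_ulim ⟨C, fun n => abs_ulim_le fun i => hC i (s n)⟩
  have hdom : Tendsto (fun n => M fun i => a i (s n)) atTop (𝓝 (M fun i => ulim V (a i))) := by
    simp only [hint _ hlim, hint _ (hcol _)]
    exact tendsto_integral_of_dominated_convergence (fun _ => C)
      (fun n => (continuous_ulim (hcol (s n))).aestronglyMeasurable) (integrable_const C)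
      (fun n => ae_of_all _ fun W => abs_ulim_le fun i => hC i (s n)) (ae_of_all _ hpoint)
  exact tendsto_nhds_unique hdom (hs none)

theorem HasDoubleLimits.map_isMean [Countable ι] (ha : HasDoubleLimits a)
    (hC : ∀ i j, |a i j| ≤ C) {N : κ → (ι → ℝ) →ₗ[ℝ] ℝ} (hN : ∀ k, IsMean (N k)) :
    HasDoubleLimits fun k j => N k fun i => a i j := fun U V => by
  obtain ⟨L, hL, hlim⟩ := exists_isMean_eq_ulim hN U
  have hcol : ∀ j, (fun i => a i j) ∈ boundedFunctions ι := fun j => ⟨C, fun i => hC i j⟩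
  simp only [← ha.isMean_map_ulim hC (hN _) V, ← hlim _ (hcol _),
    ← hlim _ (ulim_mem_boundedFunctions V hC), ha.isMean_map_ulim hC hL V]

end Representation

section Weights

variable {α : Type*} {w : α →₀ ℝ}

/-- The finitely supported probability weights on `α`: coefficients of convex combinations. -/
def weights (α : Type*) : Set (α →₀ ℝ) := convexHull ℝ (range fun i => Finsupp.single i 1)

theorem image_linearCombination_weights {E : Type*} [AddCommGroup E] [Module ℝ E] (v : α → E) :
    Finsupp.linearCombination ℝ v '' weights α = convexHull ℝ (range v) := by
  rw [weights, LinearMap.image_convexHull, ← range_comp]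
  simp only [Function.comp_def, Finsupp.linearCombination_single, one_smul]

/-- The mean `f ↦ ∑ i, w i * f i` with weights `w`. -/
noncomputable def weightedMean (w : α →₀ ℝ) : (α → ℝ) →ₗ[ℝ] ℝ :=
  Finsupp.linearCombination ℝ (fun i => LinearMap.proj i) w

theorem weightedMean_apply (w : α →₀ ℝ) (f : α → ℝ) :
    weightedMean w f = ∑ i ∈ w.support, w i * f i := by
  simp only [weightedMean, Finsupp.linearCombination_apply, Finsupp.sum, LinearMap.sum_apply,
    LinearMap.smul_apply, LinearMap.proj_apply, smul_eq_mul]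

theorem isMean_weightedMean (hw : w ∈ weights α) : IsMean (weightedMean w) :=
  convexHull_min (range_subset_iff.2 isMean_proj) convex_setOf_isMean
    (image_linearCombination_weights (LinearMap.proj (R := ℝ) (φ := fun _ : α => ℝ)) ▸
      mem_image_of_mem _ hw)

theorem tendsto_weightedMean {κ : Type*} {l : Filter κ} {f : κ → α → ℝ} {g : α → ℝ}
    (h : ∀ i, Tendsto (fun k => f k i) l (𝓝 (g i))) (w : α →₀ ℝ) :
    Tendsto (fun k => weightedMean w (f k)) l (𝓝 (weightedMean w g)) := by
  simp only [weightedMean_apply]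
  exact tendsto_finsetSum _ fun i _ => (h i).const_mul _

theorem HasDoubleLimits.tendsto_weightedMean_of_tendsto {a : ℕ → ℕ → ℝ}
    (ha : HasDoubleLimits a) {C : ℝ} (hC : ∀ i j, |a i j| ≤ C)
    {v w : ℕ → ℕ →₀ ℝ} (hv : ∀ m, v m ∈ weights ℕ)
    (hw : ∀ n, w n ∈ weights ℕ) {p q : ℕ → ℝ} {l : ℝ}
    (hp : ∀ i, Tendsto (fun n => weightedMean (w n) (a i)) atTop (𝓝 (p i)))
    (hq : ∀ j, Tendsto (fun m => weightedMean (v m) fun i => a i j) atTop (𝓝 (q j)))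
    (hl : Tendsto (fun m => weightedMean (v m) p) atTop (𝓝 l)) :
    Tendsto (fun n => weightedMean (w n) q) atTop (𝓝 l) := by
  have hrows : HasDoubleLimits fun m j => weightedMean (v m) fun i => a i j :=
    ha.map_isMean hC fun m => isMean_weightedMean (hv m)
  have hrowsC : ∀ m j, |weightedMean (v m) fun i => a i j| ≤ C := fun m j =>
    (isMean_weightedMean (hv m)).abs_map_le fun i => hC i j
  have havg : HasDoubleLimits fun m n =>
      weightedMean (w n) fun j => weightedMean (v m) fun i => a i j :=
    (hrows.swap.map_isMean (fun j m => hrowsC m j) fun n => isMean_weightedMean (hw n)).swap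
  have hcomm : ∀ m n, (weightedMean (w n) fun j => weightedMean (v m) fun i => a i j) =
      weightedMean (v m) fun i => weightedMean (w n) (a i) := fun m n => by
    simp only [weightedMean_apply, Finset.mul_sum]
    rw [Finset.sum_comm]
    simp only [mul_left_comm]
  refine havg.tendsto_of_tendsto (fun m => ?_) hl
    (fun n => tendsto_weightedMean hq (w n)) ⟨C, fun n => ?_⟩
  · simp only [hcomm]
    exact tendsto_weightedMean hp (v m)
  · exact (isMean_weightedMean (hw n)).abs_map_le fun j =>
      le_of_tendsto (hq j).abs (Eventually.of_forall fun m => hrowsC m j)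

theorem integral_weightedMean {Ω : Type*} [MeasurableSpace Ω] {μ : Measure Ω} {F : α → Ω → ℝ}
    (hF : ∀ i, Integrable (F i) μ) (w : α →₀ ℝ) :
    ∫ ω, weightedMean w (fun i => F i ω) ∂μ = weightedMean w fun i => ∫ ω, F i ω ∂μ := by
  simp only [weightedMean_apply]
  rw [integral_finsetSum _ fun i _ => (hF i).const_mul _]
  simp only [integral_const_mul]

end Weights

section Mazur

theorem mem_closure_convexHull_of_forall_tendsto {α E : Type*} [NormedAddCommGroup E]
    [NormedSpace ℝ E] {l : Filter α} [l.NeBot] {v : α → E} {x : E}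
    (h : ∀ φ : StrongDual ℝ E, Tendsto (fun i => φ (v i)) l (𝓝 (φ x))) :
    x ∈ closure (convexHull ℝ (range v)) := by
  by_contra hx
  obtain ⟨φ, u, hux, hu⟩ := geometric_hahn_banach_point_closed
    (convex_convexHull ℝ (range v)).closure isClosed_closure hx
  have hle : u ≤ φ x := ge_of_tendsto' (h φ) fun i =>
    (hu _ (subset_closure (subset_convexHull ℝ _ (mem_range_self i)))).le
  exact hle.not_gt hux

theorem exists_forall_tendsto_of_norm_le {α H : Type*} [NormedAddCommGroup H]
    [InnerProductSpace ℝ H] [CompleteSpace H] (U : Ultrafilter α) {v : α → H} {C : ℝ}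
    (hC : ∀ i, ‖v i‖ ≤ C) :
    ∃ x : H, ∀ φ : StrongDual ℝ H, Tendsto (fun i => φ (v i)) U (𝓝 (φ x)) := by
  have hbound : ∀ y i, |inner ℝ (v i) y| ≤ C * ‖y‖ := fun y i =>
    (abs_real_inner_le_norm _ _).trans (mul_le_mul_of_nonneg_right (hC i) (norm_nonneg y))
  let ψ : H →ₗ[ℝ] ℝ :=
    { toFun y := ulim U fun i => inner ℝ (v i) y
      map_add' y z := by
        simpa only [inner_add_right] using ulim_add ⟨_, hbound y⟩ ⟨_, hbound z⟩
      map_smul' c y := by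
        simpa only [real_inner_smul_right, smul_eq_mul, RingHom.id_apply] using
          ulim_smul c ⟨_, hbound y⟩ }
  let Ψ : StrongDual ℝ H := ψ.mkContinuous C fun y => abs_ulim_le (hbound y)
  refine ⟨(InnerProductSpace.toDual ℝ H).symm Ψ, fun φ => ?_⟩
  obtain ⟨y, rfl⟩ := (InnerProductSpace.toDual ℝ H).surjective φ
  simp only [InnerProductSpace.toDual_apply_apply, real_inner_comm _ y,
    InnerProductSpace.toDual_symm_apply]
  exact tendsto_ulim ⟨_, hbound y⟩

end Mazur

section WeakCompactness

variable {Ω α : Type*} [MeasurableSpace Ω] {μ : Measure Ω} {C : ℝ}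

theorem linearCombination_ae_eq_weightedMean {v : α → Lp ℝ 2 μ} {F : α → Ω → ℝ}
    (h : ∀ i, v i =ᵐ[μ] F i) (w : α →₀ ℝ) :
    Finsupp.linearCombination ℝ v w =ᵐ[μ] fun ω => weightedMean w fun i => F i ω := by
  simp only [Finsupp.linearCombination_apply, Finsupp.sum, weightedMean_apply]
  refine (Lp.coeFn_finsetSum _ _).trans ?_
  have hae : ∀ᵐ ω ∂μ, ∀ i ∈ w.support, (w i • v i : Lp ℝ 2 μ) ω = w i * F i ω :=
    (eventually_all_finset _).2 fun i _ => by
      filter_upwards [Lp.coeFn_smul (w i) (v i), h i] with ω hsmul hω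
      rw [hsmul, Pi.smul_apply, hω, smul_eq_mul]
  filter_upwards [hae] with ω hω
  simpa only [Finset.sum_apply] using Finset.sum_congr rfl hω

variable [IsFiniteMeasure μ]

theorem exists_lp_weak_limit (U : Ultrafilter α) {F : α → Ω → ℝ} (hF : ∀ i, Measurable (F i))
    (hC : ∀ i ω, |F i ω| ≤ C) :
    ∃ (w : ℕ → α →₀ ℝ) (g : Lp ℝ 2 μ), (∀ m, w m ∈ weights α) ∧
      (∀ s, MeasurableSet s →
        Tendsto (fun i => ∫ ω in s, F i ω ∂μ) U (𝓝 (∫ ω in s, g ω ∂μ))) ∧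
      ∀ᵐ ω ∂μ, Tendsto (fun m => weightedMean (w m) fun i => F i ω) atTop (𝓝 (g ω)) := by
  have hL2 : ∀ i, MemLp (F i) 2 μ := fun i =>
    .of_bound (hF i).aestronglyMeasurable C (ae_of_all _ (hC i))
  let v : α → Lp ℝ 2 μ := fun i => (hL2 i).toLp
  have hv : ∀ i, v i =ᵐ[μ] F i := fun i => (hL2 i).coeFn_toLp
  have hnorm : ∀ i, ‖v i‖ ≤ measureUnivNNReal μ ^ (2 : ℝ≥0∞).toReal⁻¹ * |C| := fun i =>
    Lp.norm_le_of_ae_bound (abs_nonneg C) <| by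
      filter_upwards [hv i] with ω hω
      exact hω ▸ (hC i ω).trans (le_abs_self C)
  obtain ⟨g, hg⟩ := exists_forall_tendsto_of_norm_le U hnorm
  obtain ⟨u, hu, hug⟩ :=
    mem_closure_iff_seq_limit.1 (mem_closure_convexHull_of_forall_tendsto hg)
  rw [← image_linearCombination_weights] at hu
  choose w hw hwu using hu
  obtain ⟨n, -, hn⟩ := (tendstoInMeasure_of_tendsto_Lp hug).exists_seq_tendsto_ae
  refine ⟨fun m => w (n m), g, fun m => hw (n m), fun s hs => ?_, ?_⟩
  · have := hg (InnerProductSpace.toDual ℝ _ (indicatorConstLp 2 hs (measure_ne_top μ s) 1))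
    simp only [InnerProductSpace.toDual_apply_apply, L2.inner_indicatorConstLp_one] at this
    exact this.congr fun i => integral_congr_ae (ae_restrict_of_ae (hv i))
  · filter_upwards [hn, ae_all_iff.2 fun m => linearCombination_ae_eq_weightedMean hv (w (n m))]
      with ω hω heq
    simpa only [← heq, hwu] using hω

theorem exists_weights_ae_tendsto (U : Ultrafilter α) {F : α → Ω → ℝ} (hF : ∀ i, Measurable (F i))
    (hC : ∀ i ω, |F i ω| ≤ C) :
    ∃ (w : ℕ → α →₀ ℝ) (G : Ω → ℝ), (∀ m, w m ∈ weights α) ∧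
      Measurable G ∧ (∀ ω, |G ω| ≤ C) ∧
      (∀ s, MeasurableSet s →
        Tendsto (fun i => ∫ ω in s, F i ω ∂μ) U (𝓝 (∫ ω in s, G ω ∂μ))) ∧
      ∀ᵐ ω ∂μ, Tendsto (fun m => weightedMean (w m) fun i => F i ω) atTop (𝓝 (G ω)) := by
  obtain ⟨w, g, hw, hint, hlim⟩ := exists_lp_weak_limit (μ := μ) U hF hC
  obtain ⟨i₀⟩ := nonempty_of_neBot (U : Filter α)
  have hle : Ω → -C ≤ C := fun ω => neg_le_self ((abs_nonneg _).trans (hC i₀ ω))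
  have hG : ∀ᵐ ω ∂μ, max (-C) (min C (g ω)) = g ω := by
    filter_upwards [hlim] with ω hω
    have : |g ω| ≤ C := le_of_tendsto' hω.abs fun m =>
      (isMean_weightedMean (hw m)).abs_map_le fun i => hC i ω
    rw [min_eq_right (abs_le.1 this).2, max_eq_right (abs_le.1 this).1]
  refine ⟨w, fun ω => max (-C) (min C (g ω)), hw, ?_, fun ω => ?_, fun s hs => ?_, ?_⟩
  · exact measurable_const.max (measurable_const.min (Lp.stronglyMeasurable g).measurable)
  · exact abs_le.2 ⟨le_max_left _ _, max_le (hle ω) (min_le_left _ _)⟩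
  · rw [integral_congr_ae (ae_restrict_of_ae hG)]
    exact hint s hs
  · filter_upwards [hlim, hG] with ω hω hωG
    rwa [hωG]

theorem setIntegral_singleton_prod {T : Type*} [MeasurableSpace T]
    (ν : Measure T) [SFinite ν] (t : T) {H : T × Ω → ℝ} (hH : Measurable H) :
    ∫ p in {t} ×ˢ univ, H p ∂ν.prod μ = ν.real {t} * ∫ ω, H (t, ω) ∂μ := by
  rw [← Measure.prod_restrict, Measure.restrict_univ, Measure.restrict_singleton,
    Measure.prod_smul_left, integral_smul_measure, Measure.dirac_prod,
    integral_map measurable_prodMk_left.aemeasurable hH.aestronglyMeasurable]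
  rfl

theorem exists_weights_forall_ae_tendsto {T : Type*} [Countable T] (U : Ultrafilter α)
    {F : T → α → Ω → ℝ} (hF : ∀ t i, Measurable (F t i)) (hC : ∀ t i ω, |F t i ω| ≤ C) :
    ∃ (w : ℕ → α →₀ ℝ) (G : T → Ω → ℝ), (∀ m, w m ∈ weights α) ∧
      (∀ t, Measurable (G t)) ∧ (∀ t ω, |G t ω| ≤ C) ∧
      (∀ t, Tendsto (fun i => ∫ ω, F t i ω ∂μ) U (𝓝 (∫ ω, G t ω ∂μ))) ∧
      ∀ᵐ ω ∂μ, ∀ t, Tendsto (fun m => weightedMean (w m) fun i => F t i ω) atTop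
        (𝓝 (G t ω)) := by
  -- A countable family is a single function on `T × Ω`, for a finite measure charging all of `T`.
  let _ : MeasurableSpace T := ⊤
  let ν : Measure T := Measure.count.toFinite
  have hν : ∀ t, ν.real {t} ≠ 0 := fun t => (measureReal_ne_zero_iff (measure_ne_top ν {t})).2
    (mt toFinite_apply_eq_zero_iff.1 (Measure.count_ne_zero (singleton_nonempty t)))
  have hF' : ∀ i, Measurable fun p : T × Ω => F p.1 i p.2 := fun i =>
    measurable_from_prod_countable_right fun t => hF t i
  obtain ⟨w, G, hw, hG, hGC, hint, hlim⟩ :=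
    exists_weights_ae_tendsto (μ := ν.prod μ) U hF' fun i p => hC p.1 i p.2
  refine ⟨w, fun t ω => G (t, ω), hw, fun t => hG.comp measurable_prodMk_left,
    fun t ω => hGC (t, ω), fun t => ?_, ae_all_iff.2 fun t => ?_⟩
  · have hslice := hint ({t} ×ˢ univ) ((MeasurableSet.singleton t).prod .univ)
    simp only [setIntegral_singleton_prod ν t hG, setIntegral_singleton_prod ν t (hF' _)] at hslice
    simpa only [inv_mul_cancel_left₀ (hν t)] using hslice.const_mul (ν.real {t})⁻¹
  · have hae := Measure.ae_ae_of_ae_prod hlim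
    rw [ae_toFinite, Measure.ae_count_iff] at hae
    exact hae t

end WeakCompactness

section RandomArrays

variable {Ω : Type*} [MeasurableSpace Ω] {μ : Measure Ω}

theorem tendsto_weightedMean_integral [IsFiniteMeasure μ] {α : Type*} {v : ℕ → α →₀ ℝ}
    (hv : ∀ m, v m ∈ weights α) {F : α → Ω → ℝ} {f : Ω → ℝ} {C : ℝ} (hF : ∀ i, Measurable (F i))
    (hC : ∀ i ω, |F i ω| ≤ C)
    (hlim : ∀ᵐ ω ∂μ, Tendsto (fun m => weightedMean (v m) fun i => F i ω) atTop (𝓝 (f ω))) :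
    Tendsto (fun m => weightedMean (v m) fun i => ∫ ω, F i ω ∂μ) atTop (𝓝 (∫ ω, f ω ∂μ)) := by
  have hint : ∀ i, Integrable (F i) μ := fun i =>
    .of_bound (hF i).aestronglyMeasurable C (ae_of_all _ (hC i))
  simp only [← integral_weightedMean hint]
  refine tendsto_integral_of_dominated_convergence (fun _ => C) (fun m => ?_) (integrable_const C)
    (fun m => ae_of_all _ fun ω => (isMean_weightedMean (hv m)).abs_map_le fun i => hC i ω) hlim
  simp only [weightedMean_apply]
  exact (Finset.measurable_sum _ fun i _ => (hF i).const_mul _).aestronglyMeasurable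

variable [IsProbabilityMeasure μ]

theorem hasDoubleLimits_integral {a : ℕ → ℕ → Ω → ℝ} {C : ℝ} (hmeas : ∀ i j, Measurable (a i j))
    (hC : ∀ i j ω, |a i j ω| ≤ C) (hdl : ∀ ω, HasDoubleLimits fun i j => a i j ω) :
    HasDoubleLimits fun i j => ∫ ω, a i j ω ∂μ := fun U V => by
  let r : ℕ → ℝ := fun i => ulim V fun j => ∫ ω, a i j ω ∂μ
  have hrC : ∀ i, |r i| ≤ C := fun i => abs_ulim_le fun j => by
    simpa only [Real.norm_eq_abs, probReal_univ, mul_one] using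
      norm_integral_le_of_norm_le_const (μ := μ) (f := a i j) (ae_of_all _ (hC i j))
  -- Carrying the constants `r i` along in the first family makes their averages converge as well.
  obtain ⟨v, G, hv, hG, hGC, hGint, hGlim⟩ := exists_weights_forall_ae_tendsto (μ := μ) U
    (F := fun t : Option ℕ => t.elim (fun i _ => r i) fun j i => a i j) (C := C)
    (by rintro (_ | j) i; exacts [measurable_const, hmeas i j])
    (by rintro (_ | j) i ω; exacts [hrC i, hC i j ω])
  obtain ⟨w, H, hw, hH, hHC, hHint, hHlim⟩ := exists_weights_forall_ae_tendsto (μ := μ) V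
    (F := fun t : Option ℕ => t.elim (fun j => G (some j)) a) (C := C)
    (by rintro (_ | i) j; exacts [hG (some j), hmeas i j])
    (by rintro (_ | i) j ω; exacts [hGC (some j) ω, hC i j ω])
  have hrow : ∀ i, ∫ ω, H (some i) ω ∂μ = r i := fun i => (ulim_eq (hHint (some i))).symm
  have hcol : ∀ j, ∫ ω, G (some j) ω ∂μ = ulim U fun i => ∫ ω, a i j ω ∂μ := fun j =>
    (ulim_eq (hGint (some j))).symm
  have hU : ulim U r = ∫ ω, G none ω ∂μ :=
    ulim_eq ((hGint none).congr fun i => by simp)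
  have hV : (ulim V fun j => ulim U fun i => ∫ ω, a i j ω ∂μ) = ∫ ω, H none ω ∂μ := by
    simp only [← hcol]
    exact ulim_eq (hHint none)
  have havg : ∀ᵐ ω ∂μ, Tendsto (fun m => weightedMean (v m) fun i => H (some i) ω) atTop
      (𝓝 (H none ω)) := by
    filter_upwards [hGlim, hHlim] with ω hGω hHω
    exact (hdl ω).swap.tendsto_weightedMean_of_tendsto (fun j i => hC i j ω) hw hv
      (fun j => hGω (some j)) (fun i => hHω (some i)) (hHω none)
  have hlim : Tendsto (fun m => weightedMean (v m) r) atTop (𝓝 (∫ ω, H none ω ∂μ)) := by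
    rw [show r = fun i => ∫ ω, H (some i) ω ∂μ from funext fun i => (hrow i).symm]
    exact tendsto_weightedMean_integral hv (fun i => hH (some i)) (fun i => hHC (some i)) havg
  have hconst : ∀ᵐ ω ∂μ, G none ω = ∫ ω, H none ω ∂μ := by
    filter_upwards [hGlim] with ω hω
    exact tendsto_nhds_unique (hω none) hlim
  change ulim U r = _
  rw [hU, hV, integral_congr_ae hconst, integral_const, probReal_univ, one_smul]

end RandomArrays

theorem IsMean.hasDoubleLimits {ι : Type*} {M : (ι → ℝ) →ₗ[ℝ] ℝ} (hM : IsMean M) {C : ℝ}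
    {a : ℕ → ℕ → ι → ℝ} (hC : ∀ i j z, |a i j z| ≤ C)
    (h : ∀ W : Ultrafilter ι, HasDoubleLimits fun i j => ulim W (a i j)) :
    HasDoubleLimits fun i j => M (a i j) := by
  borelize (Ultrafilter ι)
  obtain ⟨μ, _, hμ⟩ := hM.exists_measure
  simp only [fun i j => hμ (a i j) ⟨C, hC i j⟩]
  exact hasDoubleLimits_integral (fun i j => (continuous_ulim ⟨C, hC i j⟩).measurable)
    (fun i j W => abs_ulim_le (hC i j)) h

section Ultrapower

open BoundedContinuousFunction

variable {Y : Type*} [NormedAddCommGroup Y] (p : Ultrafilter ℕ)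

theorem tendsto_ulim_norm (g : ℕ →ᵇ Y) :
    Tendsto (fun n => ‖g n‖) p (𝓝 (ulim p fun n => ‖g n‖)) :=
  tendsto_ulim ⟨‖g‖, fun n => (abs_norm _).trans_le (g.norm_coe_le_norm n)⟩

variable [NormedSpace ℝ Y]

/-- The bounded sequences in `Y` that tend to zero along `p`. -/
def nullSequences (Y : Type*) [NormedAddCommGroup Y] [NormedSpace ℝ Y] (p : Ultrafilter ℕ) :
    Submodule ℝ (ℕ →ᵇ Y) where
  carrier := {g | Tendsto (fun n => g n) p (𝓝 0)}
  add_mem' hf hg := (add_zero (0 : Y)) ▸ Tendsto.add hf hg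
  zero_mem' := tendsto_const_nhds
  smul_mem' c _ hf := (smul_zero (A := Y) c) ▸ Tendsto.const_smul hf c

variable {p}

theorem ulim_norm_eq_of_sub_mem_nullSequences {g h : ℕ →ᵇ Y} (hgh : g - h ∈ nullSequences Y p) :
    (ulim p fun n => ‖g n‖) = ulim p fun n => ‖h n‖ := by
  have hdiff : Tendsto (fun n => ‖g n‖ - ‖h n‖) p (𝓝 0) :=
    squeeze_zero_norm (fun n => abs_norm_sub_norm_le _ _) (tendsto_zero_iff_norm_tendsto_zero.1 hgh)
  refine ulim_eq ?_
  simpa only [add_sub_cancel, add_zero] using (tendsto_ulim_norm p h).add hdiff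

variable (p)

instance isClosed_nullSequences : IsClosed (nullSequences Y p : Set (ℕ →ᵇ Y)) := by
  refine isClosed_of_closure_subset fun g hg => Metric.tendsto_nhds.2 fun ε hε => ?_
  obtain ⟨h, hh, hd⟩ := Metric.mem_closure_iff.1 hg (ε / 2) (half_pos hε)
  filter_upwards [Metric.tendsto_nhds.1 hh (ε / 2) (half_pos hε)] with n hn
  calc dist (g n) 0 ≤ dist (g n) (h n) + dist (h n) 0 := dist_triangle _ _ _
    _ < ε / 2 + ε / 2 := add_lt_add ((dist_coe_le_dist n).trans_lt hd) hn
    _ = ε := add_halves ε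

/-- The ultrapower of `Y` along an ultrafilter `p` on `ℕ`: the bounded sequences modulo those that
tend to zero along `p`. -/
abbrev SeqUltrapower (Y : Type*) [NormedAddCommGroup Y] [NormedSpace ℝ Y] (p : Ultrafilter ℕ) :=
  (ℕ →ᵇ Y) ⧸ nullSequences Y p

theorem exists_sub_mem_nullSequences_norm_le {L : ℝ} (hL : 0 ≤ L) {g : ℕ →ᵇ Y}
    (h : ∀ᶠ n in p, ‖g n‖ ≤ L) : ∃ g' : ℕ →ᵇ Y, g - g' ∈ nullSequences Y p ∧ ‖g'‖ ≤ L := by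
  classical
  have hle : ∀ n, ‖if ‖g n‖ ≤ L then g n else 0‖ ≤ L := fun n => by
    split_ifs with hn
    · exact hn
    · rwa [norm_zero]
  refine ⟨ofNormedAddCommGroupDiscrete _ L hle, Tendsto.congr' (f₁ := fun _ => 0) ?_
    tendsto_const_nhds, (norm_le hL).2 hle⟩
  filter_upwards [h] with n hn
  simp only [coe_sub, Pi.sub_apply, coe_ofNormedAddCommGroupDiscrete, if_pos hn, sub_self]

theorem norm_mkQ_nullSequences (g : ℕ →ᵇ Y) :
    ‖(nullSequences Y p).mkQ g‖ = ulim p fun n => ‖g n‖ := by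
  set L := ulim p fun n => ‖g n‖
  have hL : 0 ≤ L := ge_of_tendsto' (tendsto_ulim_norm p g) fun n => norm_nonneg _
  refine le_antisymm (le_of_forall_pos_le_add fun ε hε => ?_)
    (le_of_forall_pos_le_add fun ε hε => ?_)
  · obtain ⟨h, hgh, hle⟩ := exists_sub_mem_nullSequences_norm_le p (add_nonneg hL hε.le)
      ((tendsto_ulim_norm p g).eventually_le_const (lt_add_of_pos_right L hε))
    rw [Submodule.mkQ_apply, (Submodule.Quotient.eq _).2 hgh]
    exact (Submodule.Quotient.norm_mk_le _ h).trans hle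
  · obtain ⟨h, hh, hlt⟩ := Submodule.Quotient.norm_mk_lt ((nullSequences Y p).mkQ g) hε
    rw [Submodule.mkQ_apply, Submodule.Quotient.eq] at hh
    calc L = ulim p fun n => ‖h n‖ := (ulim_norm_eq_of_sub_mem_nullSequences hh).symm
      _ ≤ ‖h‖ := le_of_tendsto' (tendsto_ulim_norm p h) fun n => h.norm_coe_le_norm n
      _ ≤ _ := hlt.le

theorem exists_forall_norm_one_abs_norm_sub_one_le {E : Type*} [NormedAddCommGroup E]
    [NormedSpace ℝ E] [FiniteDimensional ℝ E] (s : E →ₗ[ℝ] ℕ →ᵇ Y)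
    (hs : ∀ e, (ulim p fun n => ‖s e n‖) = ‖e‖) {η : ℝ} (hη : 0 < η) :
    ∃ n, ∀ e : E, ‖e‖ = 1 → |‖s e n‖ - 1| ≤ η := by
  let S : E →L[ℝ] ℕ →ᵇ Y := LinearMap.toContinuousLinearMap s
  set δ : ℝ := η / (‖S‖ + 1)
  have hδ : 0 < δ := by positivity
  have hδη : ‖S‖ * δ + δ = η := by simp only [δ]; field_simp
  have : ProperSpace E := FiniteDimensional.proper ℝ E
  obtain ⟨t, htS, htf, htc⟩ := Metric.finite_approx_of_totallyBounded
    (isCompact_sphere (0 : E) 1).totallyBounded δ hδ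
  have hnet : ∀ᶠ n in (p : Filter ℕ), ∀ x ∈ t, |‖s x n‖ - 1| < δ := by
    refine htf.eventually_all.2 fun x hx => ?_
    have hx1 : ‖x‖ = 1 := mem_sphere_zero_iff_norm.1 (htS hx)
    exact Metric.tendsto_nhds.1 (hx1 ▸ hs x ▸ tendsto_ulim_norm p (s x)) δ hδ
  obtain ⟨n, hn⟩ := hnet.exists
  refine ⟨n, fun e he => ?_⟩
  obtain ⟨x, hx, hex⟩ := mem_iUnion₂.1 (htc (mem_sphere_zero_iff_norm.2 he))
  have hlip : |‖s e n‖ - ‖s x n‖| ≤ ‖S‖ * δ := calc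
    |‖s e n‖ - ‖s x n‖| ≤ ‖s e n - s x n‖ := abs_norm_sub_norm_le _ _
    _ = ‖S (e - x) n‖ := by rw [map_sub]; rfl
    _ ≤ ‖S (e - x)‖ := norm_coe_le_norm _ n
    _ ≤ ‖S‖ * ‖e - x‖ := S.le_opNorm _
    _ ≤ ‖S‖ * δ := by gcongr; exact (mem_ball_iff_norm.1 hex).le
  calc |‖s e n‖ - 1| ≤ |‖s e n‖ - ‖s x n‖| + |‖s x n‖ - 1| := abs_sub_le _ _ _
    _ ≤ ‖S‖ * δ + δ := add_le_add hlip (hn x hx).le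
    _ = η := hδη

theorem exists_almost_isometry_of_abs_norm_sub_one_le {E : Type*} [NormedAddCommGroup E]
    [NormedSpace ℝ E] (T : E →ₗ[ℝ] Y) {ε : ℝ} (hε : 0 < ε)
    (hT : ∀ e : E, ‖e‖ = 1 → |‖T e‖ - 1| ≤ ε / (2 + ε)) :
    ∃ T' : E →ₗ[ℝ] Y, ∀ e, ‖e‖ ≤ ‖T' e‖ ∧ ‖T' e‖ ≤ (1 + ε) * ‖e‖ := by
  have hT' : ∀ e : E, (1 - ε / (2 + ε)) * ‖e‖ ≤ ‖T e‖ ∧ ‖T e‖ ≤ (1 + ε / (2 + ε)) * ‖e‖ := by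
    intro e
    rcases eq_or_ne e 0 with rfl | he
    · simp only [map_zero, norm_zero, mul_zero, le_refl, and_self]
    have he' : 0 < ‖e‖ := norm_pos_iff.2 he
    have hunit := abs_le.1 (hT (‖e‖⁻¹ • e) (norm_smul_inv_norm (𝕜 := ℝ) he))
    rw [map_smul, norm_smul, norm_inv, norm_norm, inv_mul_eq_div] at hunit
    rw [← le_div_iff₀ he', ← div_le_iff₀ he']
    constructor <;> linarith
  have hlow : (1 + ε / 2) * (1 - ε / (2 + ε)) = 1 := by field_simp; ring
  have hupp : (1 + ε / 2) * (1 + ε / (2 + ε)) = 1 + ε := by field_simp; ring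
  refine ⟨(1 + ε / 2) • T, fun e => ?_⟩
  rw [LinearMap.smul_apply, norm_smul, Real.norm_of_nonneg (by positivity)]
  constructor
  · calc ‖e‖ = (1 + ε / 2) * ((1 - ε / (2 + ε)) * ‖e‖) := by rw [← mul_assoc, hlow, one_mul]
      _ ≤ (1 + ε / 2) * ‖T e‖ := by gcongr; exact (hT' e).1
  · calc (1 + ε / 2) * ‖T e‖ ≤ (1 + ε / 2) * ((1 + ε / (2 + ε)) * ‖e‖) := by
          gcongr; exact (hT' e).2
      _ = (1 + ε) * ‖e‖ := by rw [← mul_assoc, hupp]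

theorem finitelyRepresentable_of_norm_eq_ulim {W : Type*} [NormedAddCommGroup W] [NormedSpace ℝ W]
    (ψ : (ℕ →ᵇ Y) →ₗ[ℝ] W) (hψ : Function.Surjective ψ)
    (hnorm : ∀ g, ‖ψ g‖ = ulim p fun n => ‖g n‖) : FinitelyRepresentable W Y := by
  intro E _ ε hε
  obtain ⟨r, hr⟩ := ψ.exists_rightInverse_of_surjective (LinearMap.range_eq_top.2 hψ)
  have hs : ∀ e : E, (ulim p fun n => ‖r.comp E.subtype e n‖) = ‖e‖ := fun e => by
    rw [← hnorm]
    exact congrArg norm (LinearMap.congr_fun hr e.1)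
  obtain ⟨n, hn⟩ := exists_forall_norm_one_abs_norm_sub_one_le p _ hs
    (show 0 < ε / (2 + ε) by positivity)
  exact exists_almost_isometry_of_abs_norm_sub_one_le
    ((evalCLM ℝ n).toLinearMap ∘ₗ r ∘ₗ E.subtype) hε hn

end Ultrapower

section Truncation

theorem tendsto_atTop_or_exists_eventually_le {α : Type*} (U : Ultrafilter α) (f : α → ℝ) :
    Tendsto f U atTop ∨ ∃ R, ∀ᶠ i in (U : Filter α), f i ≤ R := by
  refine or_iff_not_imp_right.2 fun h => tendsto_atTop.2 fun R => ?_
  filter_upwards [U.eventually_not.2 fun hR => h ⟨R, hR⟩] with i hi using (not_le.1 hi).le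

variable {A : Type*} {d : PseudoMetric A ℝ} {x y : ℕ → A} {o : A} {U V : Ultrafilter ℕ}

theorem ulim_min_eq_of_tendsto_atTop (hy : Tendsto (fun j => d (y j) o) V atTop) (z : A) (C : ℝ) :
    (ulim V fun j => min (d z (y j)) C) = C := by
  refine ulim_eq (tendsto_const_nhds.congr' ?_)
  filter_upwards [hy.eventually_ge_atTop (C + d z o)] with j hj
  rw [min_eq_right]
  linarith [d.triangle (y j) z o, d.symm z (y j)]

theorem ulim_ulim_min_eq_of_tendsto_atTop (hx : Tendsto (fun i => d (x i) o) U atTop)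
    (y : ℕ → A) (V : Ultrafilter ℕ) (C : ℝ) :
    (ulim U fun i => ulim V fun j => min (d (x i) (y j)) C) = C := by
  refine ulim_eq (tendsto_const_nhds.congr' ?_)
  rcases tendsto_atTop_or_exists_eventually_le V fun j => d (y j) o with hy | ⟨R, hR⟩
  · exact Eventually.of_forall fun i => (ulim_min_eq_of_tendsto_atTop hy (x i) C).symm
  · filter_upwards [hx.eventually_ge_atTop (C + R)] with i hi
    refine (ulim_eq (tendsto_const_nhds.congr' ?_)).symm
    filter_upwards [hR] with j hj
    rw [min_eq_right]
    linarith [d.triangle (x i) (y j) o]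

theorem exists_isBoundedSeq_eventuallyEq {R : ℝ}
    (h : ∀ᶠ i in (U : Filter ℕ), d (x i) o ≤ R) :
    ∃ x' : ℕ → A, IsBoundedSeq d x' ∧ x' =ᶠ[U] x := by
  classical
  have hR : ∀ i, d (if d (x i) o ≤ R then x i else o) o ≤ |R| := fun i => by
    split_ifs with hi
    · exact hi.trans (le_abs_self R)
    · exact (d.refl o).trans_le (abs_nonneg R)
  refine ⟨fun i => if d (x i) o ≤ R then x i else o, ⟨|R| + |R|, fun i j => ?_⟩, ?_⟩
  · exact (d.triangle _ o _).trans (add_le_add (hR i) ((d.symm _ _).trans_le (hR j)))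
  · filter_upwards [h] with i hi using if_pos hi

theorem ulim_ulim_min_comm_of_isBoundedSeq (hd : d.IsStable) (hx : IsBoundedSeq d x)
    (hy : IsBoundedSeq d y) (hU : ∀ n, U ≠ pure n) (hV : ∀ n, V ≠ pure n) (C : ℝ) :
    (ulim U fun i => ulim V fun j => min (d (x i) (y j)) C) =
      ulim V fun j => ulim U fun i => min (d (x i) (y j)) C := by
  obtain ⟨g, h, L, hg, hh, hgL, hhL⟩ := hd x y hx hy U V hU hV
  simp only [fun i => ulim_eq ((hg i).min (tendsto_const_nhds (x := C))),
    fun j => ulim_eq ((hh j).min (tendsto_const_nhds (x := C))),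
    ulim_eq (hgL.min (tendsto_const_nhds (x := C))),
    ulim_eq (hhL.min (tendsto_const_nhds (x := C)))]

theorem hasDoubleLimits_min_of_isStable (hd : d.IsStable) (x y : ℕ → A) (C : ℝ) :
    HasDoubleLimits fun i j => min (d (x i) (y j)) C := by
  intro U V
  by_cases hU : ∃ n, U = pure n
  · obtain ⟨n, rfl⟩ := hU
    simp only [ulim_pure]
  by_cases hV : ∃ n, V = pure n
  · obtain ⟨n, rfl⟩ := hV
    simp only [ulim_pure]
  rcases tendsto_atTop_or_exists_eventually_le U fun i => d (x i) (x 0) with hx | ⟨R, hR⟩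
  · have hcol : ∀ j, (ulim U fun i => min (d (x i) (y j)) C) = C := fun j => by
      simpa only [d.symm (y j)] using ulim_min_eq_of_tendsto_atTop hx (y j) C
    simp only [ulim_ulim_min_eq_of_tendsto_atTop hx y V C, hcol, ulim_const]
  rcases tendsto_atTop_or_exists_eventually_le V fun j => d (y j) (x 0) with hy | ⟨S, hS⟩
  · have hcol := ulim_ulim_min_eq_of_tendsto_atTop hy x U C
    simp only [d.symm (y _)] at hcol
    simp only [hcol, ulim_min_eq_of_tendsto_atTop hy, ulim_const]
  obtain ⟨x', hx', hxx⟩ := exists_isBoundedSeq_eventuallyEq hR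
  obtain ⟨y', hy', hyy⟩ := exists_isBoundedSeq_eventuallyEq hS
  have hrow : ∀ i, (ulim V fun j => min (d (x i) (y j)) C) =
      ulim V fun j => min (d (x i) (y' j)) C := fun i =>
    ulim_congr (hyy.mono fun j hj => by simp only [hj])
  have hcol : ∀ j, (ulim U fun i => min (d (x i) (y j)) C) =
      ulim U fun i => min (d (x' i) (y j)) C := fun j =>
    ulim_congr (hxx.mono fun i hi => by simp only [hi])
  simp only [hrow, hcol]
  rw [ulim_congr (hxx.mono fun i hi => by simp only [hi])
      (g := fun i => ulim V fun j => min (d (x' i) (y' j)) C),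
    ulim_congr (hyy.mono fun j hj => by simp only [hj])
      (g := fun j => ulim U fun i => min (d (x' i) (y' j)) C)]
  exact ulim_ulim_min_comm_of_isBoundedSeq hd hx' hy' (not_exists.1 hU) (not_exists.1 hV) C

end Truncation

section Superstable

theorem norm_sub_mem_boundedFunctions {ι E : Type*} [SeminormedAddCommGroup E] {u v : ι → E}
    (hu : (fun z => ‖u z‖) ∈ boundedFunctions ι) (hv : (fun z => ‖v z‖) ∈ boundedFunctions ι) :
    (fun z => ‖u z - v z‖) ∈ boundedFunctions ι := by
  obtain ⟨R, hR⟩ := add_mem hu hv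
  exact ⟨R, fun z => (abs_norm _).trans_le ((norm_sub_le _ _).trans ((le_abs_self _).trans (hR z)))⟩

open BoundedContinuousFunction

variable {Y : Type*} [NormedAddCommGroup Y] [NormedSpace ℝ Y]

/-- The isometric linear embedding of the bounded sequences in `Y` into those in its completion. -/
noncomputable def boundedSeqToCompletion (Y : Type*) [NormedAddCommGroup Y] [NormedSpace ℝ Y] :
    (ℕ →ᵇ Y) →L[ℝ] ℕ →ᵇ UniformSpace.Completion Y :=
  UniformSpace.Completion.toComplL.compLeftContinuousBounded ℕ

theorem exists_sub_boundedSeqToCompletion_mem_nullSequences {p : Ultrafilter ℕ}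
    (hp : (p : Filter ℕ) ≤ atTop) (g : ℕ →ᵇ UniformSpace.Completion Y) :
    ∃ h : ℕ →ᵇ Y, g - boundedSeqToCompletion Y h ∈ nullSequences (UniformSpace.Completion Y) p := by
  have hdense : ∀ n : ℕ, ∃ y : Y, ‖g n - y‖ < 1 / (n + 1) := fun n =>
    (UniformSpace.Completion.denseRange_coe (α := Y)).exists_dist_lt (g n)
      Nat.one_div_pos_of_nat |>.imp fun y hy => by rwa [← dist_eq_norm]
  choose h hh using hdense
  have hbdd : ∀ n, ‖h n‖ ≤ ‖g‖ + 1 := fun n => by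
    have hle : ‖g n - h n‖ ≤ 1 :=
      (hh n).le.trans ((Nat.one_div_le_one_div n.zero_le).trans_eq (by norm_num))
    rw [← UniformSpace.Completion.norm_coe]
    linarith [norm_le_norm_add_norm_sub (g n) (h n : UniformSpace.Completion Y),
      g.norm_coe_le_norm n]
  refine ⟨ofNormedAddCommGroupDiscrete h _ hbdd, tendsto_zero_iff_norm_tendsto_zero.2 ?_⟩
  exact squeeze_zero (fun n => norm_nonneg _) (fun n => (hh n).le)
    (tendsto_one_div_add_atTop_nhds_zero_nat.mono_left hp)

/-- The map from bounded sequences in `Y` to the ultrapower of the completion of `Y`. The completion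
makes the ultrapower a Banach space when `Y` is only a normed space. -/
noncomputable def toSeqUltrapower (p : Ultrafilter ℕ) :
    (ℕ →ᵇ Y) →ₗ[ℝ] SeqUltrapower (UniformSpace.Completion Y) p :=
  (nullSequences (UniformSpace.Completion Y) p).mkQ ∘ₗ (boundedSeqToCompletion Y).toLinearMap

theorem norm_toSeqUltrapower (p : Ultrafilter ℕ) (g : ℕ →ᵇ Y) :
    ‖toSeqUltrapower p g‖ = ulim p fun n => ‖g n‖ :=
  (norm_mkQ_nullSequences p _).trans
    (congrArg (ulim p) (funext fun n => UniformSpace.Completion.norm_coe (g n)))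

theorem surjective_toSeqUltrapower {p : Ultrafilter ℕ} (hp : (p : Filter ℕ) ≤ atTop) :
    Function.Surjective (toSeqUltrapower (Y := Y) p) := fun w => by
  obtain ⟨g, rfl⟩ := Submodule.mkQ_surjective _ w
  obtain ⟨h, hh⟩ := exists_sub_boundedSeqToCompletion_mem_nullSequences hp g
  exact ⟨h, ((Submodule.Quotient.eq _).2 hh).symm⟩

theorem IsSuperstable.hasDoubleLimits_min_ulim (hY : IsSuperstable Y) {p : Ultrafilter ℕ}
    (hp : (p : Filter ℕ) ≤ atTop) (x y : ℕ → ℕ →ᵇ Y) (C : ℝ) :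
    HasDoubleLimits fun i j => min (ulim p fun n => ‖x i n - y j n‖) C := by
  have hstable := hY _ (finitelyRepresentable_of_norm_eq_ulim p (toSeqUltrapower p)
    (surjective_toSeqUltrapower hp) (norm_toSeqUltrapower p))
  have hnorm : ∀ i j, normMetric _ (toSeqUltrapower p (x i)) (toSeqUltrapower p (y j)) =
      ulim p fun n => ‖x i n - y j n‖ := fun i j =>
    (congrArg norm (map_sub _ _ _).symm).trans (norm_toSeqUltrapower p (x i - y j))
  simpa only [hnorm] using hasDoubleLimits_min_of_isStable hstable
    (fun i => toSeqUltrapower p (x i)) (fun j => toSeqUltrapower p (y j)) C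

theorem IsSuperstable.hasDoubleLimits_ulim_min (hY : IsSuperstable Y) {ι : Type*}
    {x y : ℕ → ι → Y} (hx : ∀ i, (fun z => ‖x i z‖) ∈ boundedFunctions ι)
    (hy : ∀ j, (fun z => ‖y j z‖) ∈ boundedFunctions ι) (W : Ultrafilter ι) (C : ℝ) :
    HasDoubleLimits fun i j => ulim W fun z => min ‖x i z - y j z‖ C := by
  have hlim : ∀ k : ℕ × ℕ, Tendsto (fun z => ‖x k.1 z - y k.2 z‖) W
      (𝓝 (ulim W fun z => ‖x k.1 z - y k.2 z‖)) := fun k =>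
    tendsto_ulim (norm_sub_mem_boundedFunctions (hx k.1) (hy k.2))
  obtain ⟨s, hs⟩ := exists_seq_tendsto_of_tendsto_ultrafilter W hlim
  have hseq : ∀ i j, (ulim W fun z => min ‖x i z - y j z‖ C) =
      min (ulim (hyperfilter ℕ) fun n => ‖x i (s n) - y j (s n)‖) C := fun i j => by
    rw [ulim_eq ((hs (i, j)).mono_left Nat.hyperfilter_le_atTop)]
    exact ulim_eq ((hlim (i, j)).min tendsto_const_nhds)
  choose Rx hRx using hx
  choose Ry hRy using hy
  simp only [hseq]
  exact hY.hasDoubleLimits_min_ulim Nat.hyperfilter_le_atTop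
    (fun i => ofNormedAddCommGroupDiscrete (x i ∘ s) (Rx i) fun n =>
      (le_abs_self _).trans (hRx i (s n)))
    (fun j => ofNormedAddCommGroupDiscrete (y j ∘ s) (Ry j) fun n =>
      (le_abs_self _).trans (hRy j (s n))) C

theorem IsSuperstable.hasDoubleLimits_mean_min (hY : IsSuperstable Y) {ι : Type*}
    {M : (ι → ℝ) →ₗ[ℝ] ℝ} (hM : IsMean M) {x y : ℕ → ι → Y}
    (hx : ∀ i, (fun z => ‖x i z‖) ∈ boundedFunctions ι)
    (hy : ∀ j, (fun z => ‖y j z‖) ∈ boundedFunctions ι) {C : ℝ} (hC : 0 ≤ C) :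
    HasDoubleLimits fun i j => M fun z => min ‖x i z - y j z‖ C :=
  hM.hasDoubleLimits (fun _ _ _ => (abs_of_nonneg (le_min (norm_nonneg _) hC)).trans_le
    (min_le_right _ _)) fun W => hY.hasDoubleLimits_ulim_min hx hy W C

end Superstable

section Tails

variable {ι α β E : Type*} [SeminormedAddCommGroup E] {M : (ι → ℝ) →ₗ[ℝ] ℝ} {f : ι → ℝ}
  {w w' : ι → E} {C D K S : ℝ}

theorem excess_mem_boundedFunctions (hf : f ∈ boundedFunctions ι) (C : ℝ) :
    (fun z => max (f z - C) 0) ∈ boundedFunctions ι := by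
  obtain ⟨B, hB⟩ := sub_mem hf (const_mem_boundedFunctions C)
  refine ⟨B, fun z => ?_⟩
  exact (abs_max_le_max_abs_abs.trans_eq
    (max_eq_left (abs_zero.trans_le (abs_nonneg _)))).trans (hB z)

/-- The mean of the part of `‖w‖` that exceeds the level `C`. -/
def meanExcess (M : (ι → ℝ) →ₗ[ℝ] ℝ) (C : ℝ) (w : ι → E) : ℝ := M fun z => max (‖w z‖ - C) 0

theorem meanExcess_nonneg (hM : IsMean M) (hw : (fun z => ‖w z‖) ∈ boundedFunctions ι) :
    0 ≤ meanExcess M C w :=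
  hM.nonneg _ (excess_mem_boundedFunctions hw C) fun _ => le_max_right _ _

theorem meanExcess_anti (hM : IsMean M) (hw : (fun z => ‖w z‖) ∈ boundedFunctions ι)
    (hCD : C ≤ D) : meanExcess M D w ≤ meanExcess M C w :=
  hM.mono (excess_mem_boundedFunctions hw D) (excess_mem_boundedFunctions hw C) fun _ =>
    max_le_max_right 0 (sub_le_sub_left hCD _)

theorem meanExcess_le (hM : IsMean M) (hw : (fun z => ‖w z‖) ∈ boundedFunctions ι) (C : ℝ) :
    meanExcess M C w ≤ (M fun z => ‖w z‖) + |C| := calc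
  meanExcess M C w ≤ M ((fun z => ‖w z‖) + fun _ => |C|) :=
    hM.mono (excess_mem_boundedFunctions hw C) (add_mem hw (const_mem_boundedFunctions _))
      fun z => max_le (by
        rw [Pi.add_apply]
        linarith [neg_abs_le C]) (add_nonneg (norm_nonneg _) (abs_nonneg C))
  _ = (M fun z => ‖w z‖) + |C| := by rw [map_add, hM.map_const]

theorem map_min_add_meanExcess (w : ι → E) (C : ℝ) :
    (M fun z => min ‖w z‖ C) + meanExcess M C w = M fun z => ‖w z‖ := by
  rw [meanExcess, ← map_add]
  refine congrArg M (funext fun z => ?_)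
  rw [Pi.add_apply]
  grind

theorem meanExcess_sub_two_mul_le (hM : IsMean M) (hw : (fun z => ‖w z‖) ∈ boundedFunctions ι)
    (hw' : (fun z => ‖w' z‖) ∈ boundedFunctions ι) (C : ℝ) :
    meanExcess M (2 * C) (w - w') ≤ meanExcess M C w + meanExcess M C w' := by
  have hmono := hM.mono
    (excess_mem_boundedFunctions (norm_sub_mem_boundedFunctions hw hw') (2 * C))
    (add_mem (excess_mem_boundedFunctions hw C) (excess_mem_boundedFunctions hw' C)) fun z => by
      have := norm_sub_le (w z) (w' z)
      simp only [Pi.add_apply]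
      grind
  rwa [map_add] at hmono

theorem max_sub_add_max_sub_le {a b : ℝ} (hC : 0 ≤ C) :
    max (a - (C + K)) 0 + max (b - (C + K)) 0 ≤ max (|a - b| - C) 0 + 2 * max (min a b - K) 0 := by
  grind

theorem max_min_sub_le {a b c L : ℝ} (hac : a ≤ c) (hb : 0 ≤ b) (hc : 0 ≤ c)
    (hKL : K ≤ L) (hL : 0 < L) :
    max (min a b - K) 0 + max (b - L) 0 ≤ max (b - K) 0 + c / L * b := by
  rcases le_total b L with hbL | hbL
  · have : 0 ≤ c / L * b := by positivity
    grind
  · have : c ≤ c / L * b := by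
      rw [div_mul_eq_mul_div, le_div_iff₀ hL]
      gcongr
    grind

-- The difference can lose the overlap of the tails of `w` and `w'`. Where `‖w'‖` exceeds `L`, the
-- overlap is at most `c`, and by Chebyshev's inequality it has mean at most `c / L * M ‖w'‖` there.
theorem meanExcess_add_meanExcess_le (hM : IsMean M) {c L : ℝ} (hwc : ∀ z, ‖w z‖ ≤ c)
    (hw' : (fun z => ‖w' z‖) ∈ boundedFunctions ι) (hC : 0 ≤ C) (hKL : K ≤ L)
    (hL : 0 < L) :
    meanExcess M (C + K) w + meanExcess M (C + K) w' + 2 * meanExcess M L w' ≤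
      meanExcess M C (w - w') + 2 * meanExcess M K w' + 2 * (c / L) * M fun z => ‖w' z‖ := by
  have hw : (fun z => ‖w z‖) ∈ boundedFunctions ι := ⟨c, fun z => (abs_norm _).trans_le (hwc z)⟩
  have hmono := hM.mono
    (add_mem (add_mem (excess_mem_boundedFunctions hw (C + K))
      (excess_mem_boundedFunctions hw' (C + K)))
      (Submodule.smul_mem _ 2 (excess_mem_boundedFunctions hw' L)))
    (add_mem (add_mem (excess_mem_boundedFunctions (norm_sub_mem_boundedFunctions hw hw') C)
      (Submodule.smul_mem _ 2 (excess_mem_boundedFunctions hw' K)))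
      (Submodule.smul_mem _ (2 * (c / L)) hw')) fun z => by
      simp only [Pi.add_apply, Pi.smul_apply, smul_eq_mul]
      have hdiff : max (|‖w z‖ - ‖w' z‖| - C) 0 ≤ max (‖w z - w' z‖ - C) 0 :=
        max_le_max_right 0 (sub_le_sub_right (abs_norm_sub_norm_le _ _) C)
      linarith [max_sub_add_max_sub_le (a := ‖w z‖) (b := ‖w' z‖) (K := K) hC,
        max_min_sub_le (hwc z) (norm_nonneg (w' z)) ((norm_nonneg _).trans (hwc z)) hKL hL]
  simpa only [map_add, map_smul, smul_eq_mul, meanExcess, Pi.sub_apply] using hmono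

/-- A family of functions with values in a normed space whose norms are bounded functions with
means at most `S`. -/
structure IsMeanBounded (M : (ι → ℝ) →ₗ[ℝ] ℝ) (S : ℝ) (u : α → ι → E) : Prop where
  norm_mem : ∀ i, (fun z => ‖u i z‖) ∈ boundedFunctions ι
  map_norm_le : ∀ i, (M fun z => ‖u i z‖) ≤ S

/-- The mean of the norms of the functions `u i` that escapes to infinity as `i` tends to `U`. -/
noncomputable def escapingMass (M : (ι → ℝ) →ₗ[ℝ] ℝ) (U : Ultrafilter α) (u : α → ι → E) : ℝ :=
  ⨅ C : ℝ, ulim U fun i => meanExcess M C (u i)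

variable {u : α → ι → E} {v : β → ι → E} {U : Ultrafilter α} {V : Ultrafilter β}

theorem IsMeanBounded.sub (hM : IsMean M) (hu : IsMeanBounded M S u) (hv : IsMeanBounded M S v) :
    IsMeanBounded M (S + S) fun k : α × β => u k.1 - v k.2 where
  norm_mem k := norm_sub_mem_boundedFunctions (hu.norm_mem k.1) (hv.norm_mem k.2)
  map_norm_le k :=
    (hM.mono (norm_sub_mem_boundedFunctions (hu.norm_mem k.1) (hv.norm_mem k.2))
      (add_mem (hu.norm_mem k.1) (hv.norm_mem k.2)) fun _ => norm_sub_le _ _).trans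
      ((map_add M _ _).trans_le (add_le_add (hu.map_norm_le k.1) (hv.map_norm_le k.2)))

theorem IsMeanBounded.abs_meanExcess_le (hM : IsMean M) (hu : IsMeanBounded M S u) (C : ℝ)
    (i : α) : |meanExcess M C (u i)| ≤ S + |C| := by
  rw [abs_of_nonneg (meanExcess_nonneg hM (hu.norm_mem i))]
  exact (meanExcess_le hM (hu.norm_mem i) C).trans (add_le_add_left (hu.map_norm_le i) _)

theorem IsMeanBounded.tendsto_ulim_meanExcess (hM : IsMean M) (hu : IsMeanBounded M S u)
    (U : Ultrafilter α) :
    Tendsto (fun C => ulim U fun i => meanExcess M C (u i)) atTop (𝓝 (escapingMass M U u)) := by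
  have hlim := fun C => tendsto_ulim (U := U) ⟨_, hu.abs_meanExcess_le hM C⟩
  refine tendsto_atTop_ciInf (fun C D hCD => ?_) ⟨0, ?_⟩
  · exact le_of_tendsto_of_tendsto' (hlim D) (hlim C) fun i =>
      meanExcess_anti hM (hu.norm_mem i) hCD
  · rintro _ ⟨C, rfl⟩
    exact ge_of_tendsto' (hlim C) fun i => meanExcess_nonneg hM (hu.norm_mem i)

theorem IsMeanBounded.ulim_ulim_meanExcess_le (hM : IsMean M) (hu : IsMeanBounded M S u)
    (hv : IsMeanBounded M S v) (U : Ultrafilter α) (V : Ultrafilter β) (C : ℝ) :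
    (ulim U fun i => ulim V fun j => meanExcess M (2 * C) (u i - v j)) ≤
      (ulim U fun i => meanExcess M C (u i)) + ulim V fun j => meanExcess M C (v j) := by
  have hbound := fun i j => (hu.sub hM hv).abs_meanExcess_le hM (2 * C) (i, j)
  refine le_of_tendsto_of_tendsto' (tendsto_ulim (ulim_mem_boundedFunctions V hbound))
    ((tendsto_ulim ⟨_, hu.abs_meanExcess_le hM C⟩).add_const _) fun i => ?_
  exact le_of_tendsto_of_tendsto' (tendsto_ulim ⟨_, hbound i⟩)
    ((tendsto_ulim ⟨_, hv.abs_meanExcess_le hM C⟩).const_add _) fun j =>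
      meanExcess_sub_two_mul_le hM (hu.norm_mem i) (hv.norm_mem j) C

theorem IsMeanBounded.meanExcess_add_ulim_meanExcess_le (hM : IsMean M)
    (hu : IsMeanBounded M S u) (hv : IsMeanBounded M S v) (V : Ultrafilter β) (hC : 0 ≤ C) (K : ℝ)
    (i : α) :
    meanExcess M (C + K) (u i) + (ulim V fun j => meanExcess M (C + K) (v j)) +
        2 * escapingMass M V v ≤
      (ulim V fun j => meanExcess M C (u i - v j)) + 2 * ulim V fun j => meanExcess M K (v j) := by
  obtain ⟨c, hc⟩ := hu.norm_mem i
  have hlim := fun D => tendsto_ulim (U := V) ⟨_, hv.abs_meanExcess_le hM D⟩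
  have hlim' := tendsto_ulim (U := V) ⟨_, fun j => (hu.sub hM hv).abs_meanExcess_le hM C (i, j)⟩
  have herr : Tendsto (fun L : ℝ => 2 * (|c| / L) * S) atTop (𝓝 (2 * 0 * S)) :=
    ((tendsto_const_nhds.div_atTop tendsto_id).const_mul 2).mul_const S
  rw [mul_zero, zero_mul] at herr
  refine (le_of_tendsto_of_tendsto (((hv.tendsto_ulim_meanExcess hM V).const_mul 2).const_add _)
    (herr.const_add _) ?_).trans_eq (add_zero _)
  filter_upwards [eventually_ge_atTop K, eventually_gt_atTop 0] with L hKL hL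
  refine le_of_tendsto_of_tendsto' (((hlim (C + K)).const_add _).add ((hlim L).const_mul 2))
    ((hlim'.add ((hlim K).const_mul 2)).add_const _) fun j => ?_
  have hcS : 2 * (|c| / L) * (M fun z => ‖v j z‖) ≤ 2 * (|c| / L) * S :=
    mul_le_mul_of_nonneg_left (hv.map_norm_le j) (by positivity)
  have huc : ∀ z, ‖u i z‖ ≤ |c| := fun z => (abs_norm _).symm.trans_le
    ((hc z).trans (le_abs_self c))
  exact (meanExcess_add_meanExcess_le hM huc (hv.norm_mem j) hC hKL hL).trans
    (add_le_add_right hcS _)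

theorem IsMeanBounded.escapingMass_add_escapingMass_le (hM : IsMean M)
    (hu : IsMeanBounded M S u) (hv : IsMeanBounded M S v) (U : Ultrafilter α) (V : Ultrafilter β)
    (hC : 0 ≤ C) :
    escapingMass M U u + escapingMass M V v ≤
      ulim U fun i => ulim V fun j => meanExcess M C (u i - v j) := by
  have hbound := fun i j => (hu.sub hM hv).abs_meanExcess_le hM C (i, j)
  have hu' := hu.tendsto_ulim_meanExcess hM U
  have hv' := hv.tendsto_ulim_meanExcess hM V
  have hshift : Tendsto (fun K => C + K) atTop atTop := tendsto_atTop_add_const_left _ C tendsto_id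
  have hlevel : ∀ K, (ulim U fun i => meanExcess M (C + K) (u i)) +
      (ulim V fun j => meanExcess M (C + K) (v j)) + 2 * escapingMass M V v ≤
      (ulim U fun i => ulim V fun j => meanExcess M C (u i - v j)) +
        2 * ulim V fun j => meanExcess M K (v j) := fun K =>
    le_of_tendsto_of_tendsto'
      (((tendsto_ulim ⟨_, hu.abs_meanExcess_le hM (C + K)⟩).add_const _).add_const _)
      ((tendsto_ulim (ulim_mem_boundedFunctions V hbound)).add_const _)
      (hu.meanExcess_add_ulim_meanExcess_le hM hv V hC K)
  have hlim := le_of_tendsto_of_tendsto' (((hu'.comp hshift).add (hv'.comp hshift)).add_const _)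
    ((hv'.const_mul 2).const_add _) hlevel
  exact le_of_add_le_add_right hlim

theorem IsMeanBounded.tendsto_ulim_ulim_meanExcess (hM : IsMean M)
    (hu : IsMeanBounded M S u) (hv : IsMeanBounded M S v) (U : Ultrafilter α) (V : Ultrafilter β) :
    Tendsto (fun C => ulim U fun i => ulim V fun j => meanExcess M (2 * C) (u i - v j)) atTop
      (𝓝 (escapingMass M U u + escapingMass M V v)) := by
  refine tendsto_of_tendsto_of_tendsto_of_le_of_le' tendsto_const_nhds
    ((hu.tendsto_ulim_meanExcess hM U).add (hv.tendsto_ulim_meanExcess hM V)) ?_ ?_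
  · filter_upwards [eventually_ge_atTop 0] with C hC
    exact hu.escapingMass_add_escapingMass_le hM hv U V (by positivity)
  · exact Eventually.of_forall (hu.ulim_ulim_meanExcess_le hM hv U V)

theorem ulim_ulim_add {a b : α → β → ℝ} {A B : ℝ} (ha : ∀ i j, |a i j| ≤ A)
    (hb : ∀ i j, |b i j| ≤ B) (U : Ultrafilter α) (V : Ultrafilter β) :
    (ulim U fun i => ulim V fun j => a i j + b i j) =
      (ulim U fun i => ulim V (a i)) + ulim U fun i => ulim V (b i) := by
  simp only [fun i => ulim_add (U := V) ⟨A, ha i⟩ ⟨B, hb i⟩]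
  exact ulim_add (ulim_mem_boundedFunctions V ha) (ulim_mem_boundedFunctions V hb)

theorem IsMeanBounded.ulim_ulim_map_norm_sub (hM : IsMean M) (hu : IsMeanBounded M S u)
    (hv : IsMeanBounded M S v) (U : Ultrafilter α) (V : Ultrafilter β) (hC : 0 ≤ C) :
    (ulim U fun i => ulim V fun j => M fun z => ‖u i z - v j z‖) =
      (ulim U fun i => ulim V fun j => M fun z => min ‖u i z - v j z‖ C) +
        ulim U fun i => ulim V fun j => meanExcess M C (u i - v j) := by
  have hsplit : ∀ i j, (M fun z => ‖u i z - v j z‖) =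
      (M fun z => min ‖u i z - v j z‖ C) + meanExcess M C (u i - v j) := fun i j =>
    (map_min_add_meanExcess (u i - v j) C).symm
  simp only [hsplit]
  exact ulim_ulim_add (A := C) (fun i j => hM.abs_map_le fun z =>
    (abs_of_nonneg (le_min (norm_nonneg _) hC)).trans_le (min_le_right _ _))
    (fun i j => (hu.sub hM hv).abs_meanExcess_le hM C (i, j)) U V

theorem IsMeanBounded.hasDoubleLimits_map_norm_sub (hM : IsMean M) (hu : IsMeanBounded M S u)
    (hv : IsMeanBounded M S v)
    (h : ∀ C, 0 ≤ C → HasDoubleLimits fun i j => M fun z => min ‖u i z - v j z‖ C) :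
    HasDoubleLimits fun i j => M fun z => ‖u i z - v j z‖ := by
  intro U V
  have hUV := hu.tendsto_ulim_ulim_meanExcess hM hv U V
  have hVU := hv.tendsto_ulim_ulim_meanExcess hM hu V U
  rw [add_comm] at hVU
  have hdiff := hUV.sub hVU
  rw [sub_self] at hdiff
  refine sub_eq_zero.1 (tendsto_nhds_unique (tendsto_const_nhds.congr' ?_) hdiff)
  filter_upwards [eventually_ge_atTop 0] with C hC
  have hC' : 0 ≤ 2 * C := by positivity
  have hrow := hu.ulim_ulim_map_norm_sub hM hv U V hC'
  have hcol := hv.ulim_ulim_map_norm_sub hM hu V U hC'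
  simp only [norm_sub_rev (v _ _)] at hcol
  rw [hrow, hcol, h (2 * C) hC' U V, add_sub_add_left_eq_sub]

end Tails

theorem IsSuperstable.hasDoubleLimits_map_norm_sub {ι Y : Type*} [NormedAddCommGroup Y]
    [NormedSpace ℝ Y] (hY : IsSuperstable Y) {M : (ι → ℝ) →ₗ[ℝ] ℝ} (hM : IsMean M)
    {x y : ℕ → ι → Y} {S : ℝ} (hx : IsMeanBounded M S x) (hy : IsMeanBounded M S y) :
    HasDoubleLimits fun i j => M fun z => ‖x i z - y j z‖ :=
  hx.hasDoubleLimits_map_norm_sub hM hy fun _ hC =>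
    hY.hasDoubleLimits_mean_min hM hx.norm_mem hy.norm_mem hC

section Moduli

variable {A B : Type*} {δ d : PseudoMetric A ℝ} {d' : PseudoMetric B ℝ} {f : A → B} {s t : ℝ}

theorem compressionModulus_mono (hst : s ≤ t) :
    compressionModulus δ d' f s ≤ compressionModulus δ d' f t :=
  iInf₂_mono fun _ _ => iInf_mono' fun ht => ⟨hst.trans ht, le_rfl⟩

theorem expansionModulus_mono (hst : s ≤ t) :
    expansionModulus δ d' f s ≤ expansionModulus δ d' f t :=
  iSup₂_mono fun _ _ => iSup_mono' fun hs => ⟨hs.trans hst, le_rfl⟩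

theorem compressionModulus_le (u v : A) :
    compressionModulus δ d' f (δ u v) ≤ ENNReal.ofReal (d' (f u) (f v)) :=
  iInf₂_le_of_le u v (iInf_le_of_le le_rfl le_rfl)

theorem le_expansionModulus (u v : A) :
    ENNReal.ofReal (d' (f u) (f v)) ≤ expansionModulus δ d' f (δ u v) :=
  le_iSup₂_of_le u v (le_iSup_of_le le_rfl le_rfl)

theorem isCobounded_id (d : PseudoMetric A ℝ) : IsCobounded d id := by
  refine (iSup_le fun y => iInf_le_of_le y ?_).trans_lt ENNReal.zero_lt_top
  exact (congrArg ENNReal.ofReal (d.refl y)).trans_le ENNReal.ofReal_zero.le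

theorem IsCoarseEmbedding.isCoarseEquivalence_id (hf : IsCoarseEmbedding δ d' f)
    (hlower : ∀ x y, compressionModulus δ d' f (δ x y) ≤ ENNReal.ofReal (d x y))
    (hupper : ∀ x y, ENNReal.ofReal (d x y) ≤ expansionModulus δ d' f (δ x y)) :
    IsCoarseEquivalence δ d id := by
  refine ⟨⟨fun t ht => lt_of_le_of_lt ?_ (hf.1 t ht), ?_⟩, isCobounded_id d⟩
  · exact iSup₂_le fun x y => iSup_le fun hxy => (hupper x y).trans (expansionModulus_mono hxy)
  · refine tendsto_nhds_top_mono' hf.2 fun t => ?_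
    exact le_iInf₂ fun x y => le_iInf fun hxy => (compressionModulus_mono hxy).trans (hlower x y)

theorem isStable_of_hasDoubleLimits (o : A)
    (h : ∀ (x y : ℕ → A) (S : ℝ), (∀ i, d (x i) o ≤ S) → (∀ j, d (y j) o ≤ S) →
      HasDoubleLimits fun i j => d (x i) (y j)) : d.IsStable := by
  have hradius : ∀ x : ℕ → A, IsBoundedSeq d x → ∃ S, ∀ i, d (x i) o ≤ S := fun x ⟨C, hC⟩ =>
    ⟨C + d (x 0) o, fun i => (d.triangle (x i) (x 0) o).trans (add_le_add_left (hC i 0) _)⟩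
  intro x y hx hy U V _ _
  obtain ⟨R, hR⟩ := hradius x hx
  obtain ⟨S, hS⟩ := hradius y hy
  have hbound : ∀ i j, |d (x i) (y j)| ≤ R + S := fun i j =>
    (abs_of_nonneg (d.nonneg _ _)).trans_le ((d.triangle (x i) o (y j)).trans
      (add_le_add (hR i) ((d.symm o (y j)).trans_le (hS j))))
  have hcomm := h x y (max R S) (fun i => (hR i).trans (le_max_left _ _))
    (fun j => (hS j).trans (le_max_right _ _)) U V
  exact ⟨fun i => ulim V fun j => d (x i) (y j), fun j => ulim U fun i => d (x i) (y j), _,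
    fun i => tendsto_ulim ⟨_, hbound i⟩, fun j => tendsto_ulim ⟨_, fun i => hbound i j⟩,
    tendsto_ulim (ulim_mem_boundedFunctions V hbound),
    hcomm ▸ tendsto_ulim (ulim_mem_boundedFunctions U fun j i => hbound i j)⟩

end Moduli

section Averaging

variable {X Y : Type*} [AddCommGroup X] [NormedAddCommGroup Y] {δ : PseudoMetric X ℝ} {f : X → Y}

theorem isTranslationInvariant_normMetric (Y : Type*) [NormedAddCommGroup Y] :
    (normMetric Y).IsTranslationInvariant := fun _ _ => congrArg norm (sub_zero _).symm

theorem apply_add_add_of_isTranslationInvariant (hδ : δ.IsTranslationInvariant) (x y z : X) :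
    δ (x + z) (y + z) = δ x y := by
  rw [hδ, add_sub_add_right_eq_sub, ← hδ]

theorem compressionModulus_le_translate (hδ : δ.IsTranslationInvariant) (x y z : X) :
    compressionModulus δ (normMetric Y) f (δ x y) ≤ ENNReal.ofReal ‖f (x + z) - f (y + z)‖ :=
  apply_add_add_of_isTranslationInvariant hδ x y z ▸ compressionModulus_le (x + z) (y + z)

theorem translate_le_expansionModulus (hδ : δ.IsTranslationInvariant) (x y z : X) :
    ENNReal.ofReal ‖f (x + z) - f (y + z)‖ ≤ expansionModulus δ (normMetric Y) f (δ x y) :=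
  apply_add_add_of_isTranslationInvariant hδ x y z ▸ le_expansionModulus (x + z) (y + z)

/-- Any two translates of `f` are at bounded distance from each other. This is what is left of
coarseness once the metric of the domain is forgotten, and all that averaging needs. -/
def HasBoundedTranslates (f : X → Y) : Prop :=
  ∀ x y, (fun z => ‖f (x + z) - f (y + z)‖) ∈ boundedFunctions X

theorem IsCoarse.hasBoundedTranslates (hδ : δ.IsTranslationInvariant)
    (hf : IsCoarse δ (normMetric Y) f) : HasBoundedTranslates f := fun x y =>
  ⟨(expansionModulus δ (normMetric Y) f (δ x y)).toReal, fun z => (abs_norm _).trans_le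
    ((ENNReal.ofReal_le_iff_le_toReal (hf _ (δ.nonneg x y)).ne).1
      (translate_le_expansionModulus hδ x y z))⟩

variable {M : (X → ℝ) →ₗ[ℝ] ℝ}

/-- The average over `z`, with respect to the mean `M`, of the pseudometrics
`(x, y) ↦ ‖f (x + z) - f (y + z)‖`. -/
noncomputable def averagedMetric (hM : IsMean M) (hf : HasBoundedTranslates f) :
    PseudoMetric X ℝ where
  toFun x y := M fun z => ‖f (x + z) - f (y + z)‖
  refl' x := by simpa only [sub_self, norm_zero] using hM.map_const 0
  symm' x y := by simp only [norm_sub_rev]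
  triangle' x y w := (hM.mono (hf x w) (add_mem (hf x y) (hf y w)) fun z =>
    norm_sub_le_norm_sub_add_norm_sub _ _ _).trans_eq (map_add M _ _)

variable (hM : IsMean M) (hf : HasBoundedTranslates f)

theorem averagedMetric_apply (x y : X) :
    averagedMetric hM hf x y = M fun z => ‖f (x + z) - f (y + z)‖ := rfl

theorem isTranslationInvariant_averagedMetric (hinv : ∀ g, IsInvariantUnder M g) :
    (averagedMetric hM hf).IsTranslationInvariant := fun x y => by
  rw [averagedMetric_apply, averagedMetric_apply, ← hinv y _ (hf (x - y) 0)]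
  simp only [sub_add_add_cancel, zero_add, add_comm y]

theorem compressionModulus_le_averagedMetric (hδ : δ.IsTranslationInvariant) (x y : X) :
    compressionModulus δ (normMetric Y) f (δ x y) ≤ ENNReal.ofReal (averagedMetric hM hf x y) := by
  have h := compressionModulus_le_translate (f := f) hδ x y
  rw [← ENNReal.ofReal_toReal (ne_top_of_le_ne_top ENNReal.ofReal_ne_top (h 0))]
  exact ENNReal.ofReal_le_ofReal (hM.const_le (hf x y) fun z =>
    ENNReal.toReal_le_of_le_ofReal (norm_nonneg _) (h z))

theorem averagedMetric_le_expansionModulus (hδ : δ.IsTranslationInvariant) (x y : X) :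
    ENNReal.ofReal (averagedMetric hM hf x y) ≤ expansionModulus δ (normMetric Y) f (δ x y) := by
  by_cases htop : expansionModulus δ (normMetric Y) f (δ x y) = ∞
  · exact htop ▸ le_top
  rw [ENNReal.ofReal_le_iff_le_toReal htop]
  exact hM.le_const (hf x y) fun z =>
    (ENNReal.ofReal_le_iff_le_toReal htop).1 (translate_le_expansionModulus hδ x y z)

theorem IsSuperstable.isStable_averagedMetric [NormedSpace ℝ Y] (hY : IsSuperstable Y) :
    (averagedMetric hM hf).IsStable := by
  refine isStable_of_hasDoubleLimits 0 fun x y S hx hy => ?_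
  have hlim := hY.hasDoubleLimits_map_norm_sub hM (x := fun i z => f (x i + z) - f (0 + z))
    (y := fun j z => f (y j + z) - f (0 + z)) ⟨fun i => hf (x i) 0, hx⟩ ⟨fun j => hf (y j) 0, hy⟩
  simpa only [averagedMetric_apply, sub_sub_sub_cancel_right] using hlim

end Averaging

theorem mainTheorem4_general {X Y : Type*} [AddCommGroup X] {δ : PseudoMetric X ℝ}
    (hδ : δ.IsTranslationInvariant) [NormedAddCommGroup Y] [NormedSpace ℝ Y]
    (hY : IsSuperstable Y) :
    (∀ f : X → Y, IsCoarse δ (normMetric Y) f →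
      ∃ d : PseudoMetric X ℝ, d.IsTranslationInvariant ∧ d.IsStable ∧
        ∀ x y : X,
          compressionModulus δ (normMetric Y) f (δ x y) ≤ ENNReal.ofReal (d x y) ∧
          ENNReal.ofReal (d x y) ≤ expansionModulus δ (normMetric Y) f (δ x y)) ∧
    ((∃ f : X → Y, IsCoarseEmbedding δ (normMetric Y) f) →
      ∃ d : PseudoMetric X ℝ, d.IsTranslationInvariant ∧ d.IsStable ∧
        IsCoarseEquivalence δ d (id : X → X)) := by
  obtain ⟨M, hM, hinv⟩ := exists_isMean_forall_isInvariantUnder X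
  refine ⟨fun f hf => ?_, fun ⟨f, hf⟩ => ?_⟩
  · have hbdd := hf.hasBoundedTranslates hδ
    exact ⟨averagedMetric hM hbdd, isTranslationInvariant_averagedMetric hM hbdd hinv,
      hY.isStable_averagedMetric hM hbdd, fun x y =>
        ⟨compressionModulus_le_averagedMetric hM hbdd hδ x y,
          averagedMetric_le_expansionModulus hM hbdd hδ x y⟩⟩
  · have hbdd := hf.1.hasBoundedTranslates hδ
    exact ⟨averagedMetric hM hbdd, isTranslationInvariant_averagedMetric hM hbdd hinv,
      hY.isStable_averagedMetric hM hbdd, hf.isCoarseEquivalence_id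
        (compressionModulus_le_averagedMetric hM hbdd hδ)
        (averagedMetric_le_expansionModulus hM hbdd hδ)⟩

theorem mainTheorem4 {X Y : Type*}
    [NormedAddCommGroup X] [NormedSpace ℝ X] [CompleteSpace X]
    [NormedAddCommGroup Y] [NormedSpace ℝ Y] [CompleteSpace Y]
    (hY : IsSuperstable Y) :
    (∀ f : X → Y, IsCoarse (normMetric X) (normMetric Y) f →
      ∃ d : PseudoMetric X ℝ, d.IsTranslationInvariant ∧ d.IsStable ∧
        ∀ x y : X,
          compressionModulus (normMetric X) (normMetric Y) f ‖x - y‖ ≤ ENNReal.ofReal (d x y) ∧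
          ENNReal.ofReal (d x y) ≤ expansionModulus (normMetric X) (normMetric Y) f ‖x - y‖) ∧
    ((∃ f : X → Y, IsCoarseEmbedding (normMetric X) (normMetric Y) f) →
      ∃ d : PseudoMetric X ℝ, d.IsTranslationInvariant ∧ d.IsStable ∧
        IsCoarseEquivalence (normMetric X) d (id : X → X)) :=
  mainTheorem4_general (isTranslationInvariant_normMetric X) hY
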